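/- For every integer $a\ge 1$ let $X^{(a)}$ be an irreducible discrete-time birth-and-death chain on $\{0,1,\dots,a\}$, with transition probabilities $p_x=p^{(a)}_x>0$ for $x\to x+1$ ($0\le x\le a-1$), $q_x=q^{(a)}_x>0$ for $x\to x-1$ ($1\le x\le a$), holding probabilities $1-p_x-q_x\ge 0$, and $q_0=p_a=0$. Let $\pi^{(a)}$ be its invariant probability measure, $\pi^{(a)}(x)=\pi^{(a)}(0)\prod_{i=1}^{x}\frac{p_{i-1}}{q_i}$, and let $T^{(a)}_{x\to y}=\min\{t\ge 0: X^{(a)}(t)=y\}$ for the chain started at $x$. Put $$Q^{(a)}(x)=\frac{1}{\pi^{(a)}(\{x,\dots,a\})}\sum_{c=x}^{a}\frac{\pi^{(a)}(\{c,\dots,a\})^2}{q_c\,\pi^{(a)}(c)}\quad(1\le x\le a),\qquad Q^{(a)}=\max_{1\le x\le a}Q^{(a)}(x).$$ All the means $E[T^{(a)}_{x\to y}]$ are finite, and the following hold. (i) If $\pi^{(a)}(\{1,\dots,a\})\,Q^{(a)}(1)/E[T^{(a)}_{a\to 0}]\to 0$ as $a\to\infty$, then $E[T^{(a)}_{a\to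 0}]\ll E[T^{(a)}_{0\to a}]$, meaning that $$\lim_{a\to\infty}\frac{\max_{0\le x\le a}E[T^{(a)}_{x\to 0}]}{E[T^{(a)}_{0\to a}]}=0$$ and that the random variables $S^{(a)}=T^{(a)}_{0\to a}/E[T^{(a)}_{0\to a}]$, $a\ge1$, are uniformly integrable: for every $\varepsilon>0$ there is $K<\infty$ with $E[S^{(a)};\,S^{(a)}>K]<\varepsilon$ for all $a\ge 1$. Moreover $T^{(a)}_{0\to a}$ has escape-time behaviour at mean times: $S^{(a)}$ converges in law to the exponential distribution of mean $1$ as $a\to\infty$. (ii) If $Q^{(a)}/E[T^{(a)}_{a\to 0}]\to 0$ as $a\to\infty$, then $\mathrm{Var}\bigl(T^{(a)}_{a\to 0}/E[T^{(a)}_{a\to 0}]\bigr)\to 0$, and $T^{(a)}_{a\to 0}$ has cut-off behaviour at mean times: $T^{(a)}_{a\to 0}/E[T^{(a)}_{a\to 0}]\to 1$ in probability as $a\to\infty$. -/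

import Mathlib

open MeasureTheory ProbabilityTheory Filter Topology
open scoped ENNReal NNReal

/-- The transition probabilities of an irreducible birth-and-death chain on `{0, …, a}`:
`p x` is the probability of the step `x → x + 1`, `q x` that of the step `x → x - 1`, and
`1 - p x - q x ≥ 0` that of staying at `x`.  Only the values at `x ≤ a` matter. -/
structure BirthDeathChain (a : ℕ) where
  p : ℕ → ℝ
  q : ℕ → ℝ
  p_pos : ∀ x, x < a → 0 < p x
  p_last : p a = 0
  q_pos : ∀ x, 1 ≤ x → x ≤ a → 0 < q x
  q_zero : q 0 = 0
  add_le_one : ∀ x, x ≤ a → p x + q x ≤ 1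

namespace BirthDeathChain

variable {a : ℕ} (X : BirthDeathChain a)

/-- The probability of the step `x → y`. -/
noncomputable def trans (x y : ℕ) : ℝ :=
  if y = x + 1 then X.p x else if y + 1 = x then X.q x
    else if y = x then 1 - X.p x - X.q x else 0

lemma p_nonneg {x : ℕ} (hx : x ≤ a) : 0 ≤ X.p x := by
  rcases hx.lt_or_eq with h | h
  · exact (X.p_pos x h).le
  · rw [h, X.p_last]

lemma q_nonneg {x : ℕ} (hx : x ≤ a) : 0 ≤ X.q x := by
  rcases Nat.eq_zero_or_pos x with h | h
  · rw [h, X.q_zero]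
  · exact (X.q_pos x h hx).le

lemma trans_nonneg {x : ℕ} (hx : x ≤ a) (y : ℕ) : 0 ≤ X.trans x y := by
  have h := X.add_le_one x hx
  unfold trans
  split_ifs
  · exact X.p_nonneg hx
  · exact X.q_nonneg hx
  · linarith
  · exact le_rfl

lemma sum_trans (x : Fin (a + 1)) : ∑ y : Fin (a + 1), X.trans x y = 1 := by
  have hx : (x : ℕ) ≤ a := Nat.lt_succ_iff.mp x.2
  rw [Fin.sum_univ_eq_sum_range (fun y => X.trans x y) (a + 1)]
  have key : ∀ y : ℕ, X.trans x y = (if (x : ℕ) + 1 = y then X.p x else 0)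
      + (if (x : ℕ) = y then 1 - X.p x - X.q x else 0)
      + (if (x : ℕ) - 1 = y then X.q x else 0) := by
    intro y
    rcases Nat.eq_zero_or_pos (x : ℕ) with h | h
    · rw [h]
      rcases y with _ | _ | y <;> simp [trans, X.q_zero]
    · unfold trans
      split_ifs <;> first | omega | simp
  simp only [key, Finset.sum_add_distrib, Finset.sum_ite_eq, Finset.mem_range]
  rw [if_pos (by omega : (x : ℕ) < a + 1), if_pos (by omega : (x : ℕ) - 1 < a + 1)]
  by_cases h : (x : ℕ) + 1 < a + 1
  · rw [if_pos h]; ring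
  · have hxa : (x : ℕ) = a := by omega
    rw [if_neg h, hxa, X.p_last]; ring

lemma sum_ofReal_trans (x : Fin (a + 1)) :
    ∑ y : Fin (a + 1), ENNReal.ofReal (X.trans x y) = 1 := by
  have h := ENNReal.ofReal_sum_of_nonneg (s := Finset.univ)
    (f := fun y : Fin (a + 1) => X.trans x y)
    (fun y _ => X.trans_nonneg (Nat.lt_succ_iff.mp x.2) y)
  rw [← h, X.sum_trans, ENNReal.ofReal_one]

/-- The law of `X (t + 1)` given `X t = x`. -/
noncomputable def stepPMF (x : Fin (a + 1)) : PMF (Fin (a + 1)) :=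
  PMF.ofFintype (fun y => ENNReal.ofReal (X.trans x y)) (X.sum_ofReal_trans x)

/-- The one-step transition kernel of the chain. -/
noncomputable def stepKernel : Kernel (Fin (a + 1)) (Fin (a + 1)) where
  toFun x := (X.stepPMF x).toMeasure
  measurable' := measurable_from_top

instance : IsMarkovKernel X.stepKernel :=
  ⟨fun x => inferInstanceAs (IsProbabilityMeasure (X.stepPMF x).toMeasure)⟩

/-- The one-step transition kernel, as a function of the whole past up to time `n`. -/
noncomputable def historyKernel (n : ℕ) :
    Kernel (Π _ : Finset.Iic n, Fin (a + 1)) (Fin (a + 1)) :=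
  X.stepKernel.comap (fun h => h ⟨n, Finset.mem_Iic.mpr le_rfl⟩) (measurable_pi_apply _)

instance (n : ℕ) : IsMarkovKernel (X.historyKernel n) := by
  unfold historyKernel; infer_instance

/-- The law, on the space of trajectories, of the chain started at `z`. -/
noncomputable def pathLaw (z : Fin (a + 1)) : Measure (ℕ → Fin (a + 1)) :=
  Kernel.trajMeasure (X := fun _ => Fin (a + 1)) (Measure.dirac z) X.historyKernel

instance (z : Fin (a + 1)) : IsProbabilityMeasure (X.pathLaw z) := by
  unfold pathLaw; infer_instance

/-- The finite-dimensional distributions of the chain: this characterises `pathLaw`. -/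
lemma pathLaw_cylinder (z : Fin (a + 1)) (s : ℕ → Fin (a + 1)) (n : ℕ) :
    X.pathLaw z {ω | ∀ t ≤ n, ω t = s t} =
      if s 0 = z then ∏ t ∈ Finset.range n, ENNReal.ofReal (X.trans (s t) (s (t + 1))) else 0 := by
  have hone : ∀ s : ℕ → Fin (a + 1), ∀ n : ℕ,
      MeasurableSet {h : Π _ : Finset.Iic n, Fin (a + 1) | ∀ t : Finset.Iic n, h t = s t} :=
    fun s n => (Set.toFinite _).measurableSet
  induction n with
  | zero =>
    have hset : {ω : ℕ → Fin (a + 1) | ∀ t ≤ 0, ω t = s t} =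
        Preorder.frestrictLe (π := fun _ => Fin (a + 1)) 0 ⁻¹'
          {h : Π _ : Finset.Iic 0, Fin (a + 1) | ∀ t : Finset.Iic 0, h t = s t} := by
      ext ω; simp
    rw [hset, ← Measure.map_apply (by fun_prop) (hone s 0), pathLaw, Kernel.trajMeasure,
      Measure.map_comp _ _ (by fun_prop), Kernel.traj_map_frestrictLe, Kernel.partialTraj_self,
      Measure.id_comp, Measure.map_apply (MeasurableEquiv.measurable _) (hone s 0),
      Measure.dirac_apply' _ (MeasurableEquiv.measurable _ (hone s 0))]
    by_cases h : s 0 = z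
    · subst h
      simp [Set.indicator]
    · have h' : z ≠ s 0 := fun e => h e.symm
      simp [Set.indicator, h, h']
  | succ n ih =>
    have hset : {ω : ℕ → Fin (a + 1) | ∀ t ≤ n + 1, ω t = s t} =
        (fun ω : ℕ → Fin (a + 1) =>
          (Preorder.frestrictLe (π := fun _ => Fin (a + 1)) n ω, ω (n + 1))) ⁻¹'
          ({h : Π _ : Finset.Iic n, Fin (a + 1) | ∀ t : Finset.Iic n, h t = s t} ×ˢ
            {s (n + 1)}) := by
      ext ω
      simp only [Set.mem_ofPred_eq, Set.mem_preimage, Set.mem_prod, Set.mem_singleton_iff,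
        Subtype.forall, Finset.mem_Iic, Preorder.frestrictLe_apply]
      constructor
      · exact fun h => ⟨fun t ht => h t (by omega), h _ le_rfl⟩
      · rintro ⟨h1, h2⟩ t ht
        rcases Nat.lt_or_ge n t with h | h
        · obtain rfl : t = n + 1 := by omega
          exact h2
        · exact h1 t h
    have hset' : {ω : ℕ → Fin (a + 1) | ∀ t ≤ n, ω t = s t} =
        Preorder.frestrictLe (π := fun _ => Fin (a + 1)) n ⁻¹'
          {h : Π _ : Finset.Iic n, Fin (a + 1) | ∀ t : Finset.Iic n, h t = s t} := by
      ext ω; simp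
    have hk : ∀ h ∈ {h : Π _ : Finset.Iic n, Fin (a + 1) | ∀ t : Finset.Iic n, h t = s t},
        X.historyKernel n h {s (n + 1)} = ENNReal.ofReal (X.trans (s n) (s (n + 1))) := by
      intro h hh
      have hn : h ⟨n, Finset.mem_Iic.mpr le_rfl⟩ = s n := hh ⟨n, _⟩
      rw [historyKernel, Kernel.comap_apply, hn]
      change (X.stepPMF (s n)).toMeasure _ = _
      rw [PMF.toMeasure_apply_singleton _ _ (measurableSet_singleton _)]
      rfl
    rw [hset, ← Measure.map_apply (by fun_prop) ((hone s n).prod (measurableSet_singleton _)),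
      pathLaw, ← Kernel.map_frestrictLe_trajMeasure_compProd_eq_map_trajMeasure,
      Measure.compProd_apply_prod (hone s n) (measurableSet_singleton _),
      setLIntegral_congr_fun (hone s n) hk, setLIntegral_const,
      Measure.map_apply (by fun_prop) (hone s n), ← hset']
    change _ * X.pathLaw z _ = _
    rw [ih, Finset.prod_range_succ]
    split_ifs
    · rw [mul_comm]
    · rw [mul_zero]

/-- The hitting time `min {t ≥ 0 : ω t ∈ H}` of a set `H` (`∞` if `H` is never hit). -/
noncomputable def hit {a : ℕ} (H : Set (Fin (a + 1))) (ω : ℕ → Fin (a + 1)) : ℝ≥0∞ :=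
  ENat.toENNReal (hittingAfter (fun (t : ℕ) (ω : ℕ → Fin (a + 1)) => ω t) H 0 ω)

/-- The mean hitting time of `H` for the chain started at `x`. -/
noncomputable def meanHit (x : Fin (a + 1)) (H : Set (Fin (a + 1))) : ℝ≥0∞ :=
  ∫⁻ ω, hit H ω ∂(X.pathLaw x)

/-- The unnormalised reversible weights `∏_{i=1}^x p_{i-1} / q_i`. -/
noncomputable def weight (x : ℕ) : ℝ :=
  ∏ i ∈ Finset.Icc 1 x, X.p (i - 1) / X.q i

/-- The invariant probability measure of the chain, at the state `x`. -/
noncomputable def stat (x : ℕ) : ℝ :=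
  X.weight x / ∑ y ∈ Finset.Icc 0 a, X.weight y

/-- The mass `π({x, …, a})`. -/
noncomputable def tail (x : ℕ) : ℝ :=
  ∑ y ∈ Finset.Icc x a, X.stat y

/-- `Q(x) = π({x, …, a})⁻¹ ∑_{c=x}^a π({c, …, a})² / (q_c π(c))`, for `1 ≤ x ≤ a`. -/
noncomputable def Q (x : ℕ) : ℝ :=
  1 / X.tail x * ∑ c ∈ Finset.Icc x a, X.tail c ^ 2 / (X.q c * X.stat c)

/-- The largest of the numbers `Q(x)`, `1 ≤ x ≤ a`. -/
noncomputable def supQ : ℝ :=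
  sSup (X.Q '' Set.Icc 1 a)

lemma weight_pos {x : ℕ} (hx : x ≤ a) : 0 < X.weight x := by
  refine Finset.prod_pos fun i hi => ?_
  rw [Finset.mem_Icc] at hi
  exact div_pos (X.p_pos _ (by omega)) (X.q_pos i hi.1 (by omega))

lemma sum_weight_pos : 0 < ∑ y ∈ Finset.Icc 0 a, X.weight y :=
  Finset.sum_pos (fun _ hy => X.weight_pos (Finset.mem_Icc.mp hy).2) ⟨0, by simp⟩

lemma stat_pos {x : ℕ} (hx : x ≤ a) : 0 < X.stat x :=
  div_pos (X.weight_pos hx) X.sum_weight_pos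

lemma sum_stat : ∑ x ∈ Finset.Icc 0 a, X.stat x = 1 := by
  simp only [stat]
  rw [← Finset.sum_div, div_self X.sum_weight_pos.ne']

/-- Detailed balance. -/
lemma stat_mul_p {x : ℕ} (hx : x < a) : X.stat x * X.p x = X.stat (x + 1) * X.q (x + 1) := by
  have hq := (X.q_pos (x + 1) (by omega) (by omega)).ne'
  have hw : X.weight (x + 1) = X.weight x * (X.p x / X.q (x + 1)) := by
    unfold weight
    rw [Finset.prod_Icc_succ_top (by omega)]
    simp
  unfold stat
  rw [hw]
  field_simp

/-- `stat` is reversible for the chain. -/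
lemma stat_mul_trans {x y : ℕ} (hx : x ≤ a) (hy : y ≤ a) :
    X.stat x * X.trans x y = X.stat y * X.trans y x := by
  rcases lt_trichotomy x y with h | h | h
  · rcases Nat.lt_or_ge (x + 1) y with h' | h'
    · simp [trans, show y ≠ x + 1 by omega, show y + 1 ≠ x by omega, show y ≠ x by omega,
        show x ≠ y + 1 by omega, show x + 1 ≠ y by omega, show x ≠ y by omega]
    · obtain rfl : y = x + 1 := by omega
      simpa [trans, show x ≠ x + 1 + 1 by omega] using X.stat_mul_p (show x < a by omega)
  · rw [h]
  · rcases Nat.lt_or_ge (y + 1) x with h' | h'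
    · simp [trans, show y ≠ x + 1 by omega, show y + 1 ≠ x by omega, show y ≠ x by omega,
        show x ≠ y + 1 by omega, show x + 1 ≠ y by omega, show x ≠ y by omega]
    · obtain rfl : x = y + 1 := by omega
      simpa [trans, show y ≠ y + 1 + 1 by omega] using (X.stat_mul_p (show y < a by omega)).symm

/-- `stat` is invariant for the chain. -/
lemma sum_stat_mul_trans (y : Fin (a + 1)) :
    ∑ x : Fin (a + 1), X.stat x * X.trans x y = X.stat y := by
  have h : ∀ x : Fin (a + 1), X.stat x * X.trans x y = X.stat y * X.trans y x := fun x =>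
    X.stat_mul_trans (Nat.lt_succ_iff.mp x.2) (Nat.lt_succ_iff.mp y.2)
  simp only [h]
  rw [← Finset.mul_sum, X.sum_trans, mul_one]

end BirthDeathChain

instance isProbabilityMeasure_expMeasure_one : IsProbabilityMeasure (expMeasure 1) :=
  isProbabilityMeasure_expMeasure one_pos

/-- The family of real random variables `U / E[U]`, for a family of nonnegative random
variables `U a` on probability spaces `(Ω a, μ a)`. -/
noncomputable def normalized {Ω : ℕ → Type*} [∀ a, MeasurableSpace (Ω a)]
    (μ : ∀ a, Measure (Ω a)) (U : ∀ a, Ω a → ℝ≥0∞) (a : ℕ) (ω : Ω a) : ℝ :=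
  (U a ω / ∫⁻ ω', U a ω' ∂(μ a)).toReal

/-- Cut-off behaviour at mean times: `U / E[U] → 1` in probability. -/
def ExhibitsCutoff {Ω : ℕ → Type*} [∀ a, MeasurableSpace (Ω a)]
    (μ : ∀ a, Measure (Ω a)) (U : ∀ a, Ω a → ℝ≥0∞) : Prop :=
  ∀ ε : ℝ, 0 < ε → Tendsto (fun a => μ a {ω | ε < |normalized μ U a ω - 1|}) atTop (𝓝 0)

/-- Escape-time behaviour at mean times: `U / E[U]` converges in law to `exp(1)`. -/
def ExhibitsEscape {Ω : ℕ → Type*} [∀ a, MeasurableSpace (Ω a)]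
    (μ : ∀ a, Measure (Ω a)) [∀ a, IsProbabilityMeasure (μ a)] (U : ∀ a, Ω a → ℝ≥0∞) : Prop :=
  TendstoInDistribution (normalized μ U) atTop (id : ℝ → ℝ) μ (expMeasure 1)

/-- Uniform integrability, over `a ≥ 1`, of the family `U / E[U]`. -/
def NormalizedUnifIntegrable {Ω : ℕ → Type*} [∀ a, MeasurableSpace (Ω a)]
    (μ : ∀ a, Measure (Ω a)) (U : ∀ a, Ω a → ℝ≥0∞) : Prop :=
  ∀ ε : ℝ≥0∞, 0 < ε → ∃ K : ℝ≥0, ∀ a, 1 ≤ a →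
    ∫⁻ ω in {ω | (K : ℝ≥0∞) < U a ω / ∫⁻ ω', U a ω' ∂(μ a)},
      U a ω / ∫⁻ ω', U a ω' ∂(μ a) ∂(μ a) < ε

/-- The relation `E[T_{H → ℓ}] ≪ E[T_{ℓ → H}]` for a family of chains: the mean time to reach
`ℓ`, from the worst starting point, is negligible with respect to the mean time from `ℓ` to `H`,
and the normalised hitting times of `H` from `ℓ` are uniformly integrable. -/
def MuchShorter (X : ∀ a, BirthDeathChain a) (H : ∀ a, Set (Fin (a + 1)))
    (l : ∀ a, Fin (a + 1)) : Prop :=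
  Tendsto (fun a => (⨆ x, (X a).meanHit x {l a}) / (X a).meanHit (l a) (H a)) atTop (𝓝 0) ∧
  NormalizedUnifIntegrable (fun a => (X a).pathLaw (l a)) (fun a => BirthDeathChain.hit (H a))

/-! Put `res c = 1/(q_c π(c))`. Since `π(x)(1 - P)g(x)` is a difference of fluxes across the two
edges at `x`, the equation `(1 - P)g = r` is solved by summing twice. This gives `A = E[T_{a→0}] = ∑
res c * tail c` and `M = E[T_{0→a}] = ∑ res c * head c`. As `head + tail = 1`, `A + M = R`, the
total resistance, while `π({1,…,a}) Q(1) = ∑ res c * tail c ^ 2`.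

(i) By Cauchy–Schwarz, `A² ≤ (∑ res * tail²) R`. So the hypothesis forces `A/R → 0`, hence `A/M → 0`
and `R A / M² → 0` (`hitSum_zero_sq_le`, `ratio_bounds`). The characteristic function `g(x) =
E_x[exp(iθT)]` of the time to reach `a` solves `(1 - P)g = κ g` with `κ = 1 - exp(-iθ)`. Summing
twice and replacing `g` by `g(0)` inside the sum yields `g(0) - 1 = κ M g(0)` up to an error `θ² R
A` (`norm_hitChar_last_sub_le`). At `θ = s/M` one has `κ M → is`, because `M ≥ a`, so `g(0) → 1/(1 -
is)`, and Lévy's theorem concludes. Uniform integrability needs only `E[T²] ≤ 2M²`.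

(ii) The double sum bounding the second moment of `T_{a→0}` is at most `A² + 2 Q A`
(`two_mul_hitSqSum_le`). The normalised variance is therefore at most `2Q/A`, and Chebyshev's
inequality gives the cut-off. -/

/-! ### The Markov property of the path law at time one. -/

/-- Finite measures on sequences in a countable space agree if they agree on cylinders. -/
lemma measure_ext_of_cylinder {E : Type*} [Countable E] [MeasurableSpace E]
    [MeasurableSingletonClass E] {μ ν : Measure (ℕ → E)} [IsFiniteMeasure μ] [IsFiniteMeasure ν]
    (h : ∀ (s : ℕ → E) (n : ℕ), μ {ω | ∀ t ≤ n, ω t = s t} = ν {ω | ∀ t ≤ n, ω t = s t}) :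
    μ = ν := by
  have key : ∀ n, μ.map (Preorder.frestrictLe (π := fun _ => E) n) =
      ν.map (Preorder.frestrictLe (π := fun _ => E) n) := by
    intro n
    refine Measure.ext_of_singleton fun s => ?_
    -- A history up to time `n` is extended by the arbitrary value `s 0`; the cylinder only sees
    -- times up to `n`.
    have hs : Preorder.frestrictLe (π := fun _ => E) n ⁻¹' {s} =
        {ω | ∀ t ≤ n, ω t =
          (fun t => if ht : t ≤ n then s ⟨t, Finset.mem_Iic.mpr ht⟩
            else s ⟨0, Finset.mem_Iic.mpr n.zero_le⟩) t} := by
      ext ω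
      simp only [Set.mem_preimage, Set.mem_singleton_iff, funext_iff, Subtype.forall,
        Finset.mem_Iic, Preorder.frestrictLe_apply, Set.mem_ofPred_eq]
      refine forall₂_congr fun t ht => ?_
      rw [dif_pos ht]
    rw [Measure.map_apply (by fun_prop) (measurableSet_singleton _),
      Measure.map_apply (by fun_prop) (measurableSet_singleton _), hs]
    exact h _ n
  refine IsProjectiveLimit.unique (P := fun I : Finset ℕ => μ.map I.restrict)
    (fun I => rfl) (fun I => ?_)
  have hI := I.subset_Iic_sup_id
  change ν.map I.restrict = μ.map I.restrict
  rw [← Finset.restrict₂_comp_restrict hI, ← Measure.map_map (by fun_prop) (by fun_prop),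
    ← Measure.map_map (by fun_prop) (by fun_prop)]
  exact congrArg _ (key _).symm

/-- The sequence `x, ω 0, ω 1, …`. -/
def prepend {E : Type*} (x : E) (ω : ℕ → E) : ℕ → E
  | 0 => x
  | n + 1 => ω n

lemma measurable_prepend {E : Type*} [MeasurableSpace E] (x : E) : Measurable (prepend x) := by
  refine measurable_pi_lambda _ fun n => ?_
  cases n with
  | zero => exact measurable_const
  | succ n => exact measurable_pi_apply n

namespace BirthDeathChain

variable {a : ℕ} (X : BirthDeathChain a)

/-- On cylinders this amounts to splitting off the first factor of the product of transition
probabilities. -/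
lemma pathLaw_eq_sum (x : Fin (a + 1)) :
    X.pathLaw x = ∑ y : Fin (a + 1),
      ENNReal.ofReal (X.trans x y) • (X.pathLaw y).map (prepend x) := by
  classical
  have hP : ∀ y, IsProbabilityMeasure ((X.pathLaw y).map (prepend x)) := fun y =>
    Measure.isProbabilityMeasure_map (measurable_prepend x).aemeasurable
  have hfin : IsFiniteMeasure (∑ y : Fin (a + 1),
      ENNReal.ofReal (X.trans x y) • (X.pathLaw y).map (prepend x)) := by
    refine ⟨?_⟩
    simp only [Measure.coe_finsetSum, Finset.sum_apply, Measure.smul_apply, measure_univ,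
      smul_eq_mul, mul_one, X.sum_ofReal_trans, ENNReal.one_lt_top]
  refine measure_ext_of_cylinder fun s n => ?_
  have hm : ∀ (s : ℕ → Fin (a + 1)) (n : ℕ),
      MeasurableSet {ω : ℕ → Fin (a + 1) | ∀ t ≤ n, ω t = s t} := by
    intro s n
    have : {ω : ℕ → Fin (a + 1) | ∀ t ≤ n, ω t = s t} =
        ⋂ t, ⋂ (_ : t ≤ n), (fun ω => ω t) ⁻¹' {s t} := by ext; simp
    rw [this]
    exact MeasurableSet.iInter fun t => MeasurableSet.iInter fun _ =>
      measurable_pi_apply t (measurableSet_singleton _)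
  simp only [Measure.coe_finsetSum, Finset.sum_apply, Measure.smul_apply, smul_eq_mul]
  simp_rw [Measure.map_apply (measurable_prepend x) (hm s n)]
  rw [pathLaw_cylinder]
  cases n with
  | zero =>
    have : prepend x ⁻¹' {ω | ∀ t ≤ 0, ω t = s t} = if s 0 = x then Set.univ else ∅ := by
      ext ω
      simp only [Set.mem_preimage, Set.mem_ofPred_eq, Nat.le_zero, forall_eq, prepend]
      split_ifs with h
      · simp [h]
      · simpa using fun e => h e.symm
    simp only [this]
    split_ifs <;> simp [X.sum_ofReal_trans]
  | succ n =>
    have : prepend x ⁻¹' {ω | ∀ t ≤ n + 1, ω t = s t} =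
        if s 0 = x then {ω | ∀ t ≤ n, ω t = s (t + 1)} else ∅ := by
      ext ω
      simp only [Set.mem_preimage, Set.mem_ofPred_eq]
      constructor
      · intro h
        have h0 : s 0 = x := (h 0 (by omega)).symm
        rw [if_pos h0]
        exact fun t ht => h (t + 1) (by omega)
      · split_ifs with h
        · intro h' t ht
          cases t with
          | zero => exact h.symm
          | succ t => exact h' t (by omega)
        · exact fun h => h.elim
    simp only [this]
    split_ifs with h
    · have h' := fun y => X.pathLaw_cylinder y (fun t => s (t + 1)) n
      simp only [h', mul_ite, mul_zero, Finset.sum_ite_eq, Finset.mem_univ, if_true]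
      rw [Finset.prod_range_succ', h, mul_comm]
    · simp

lemma lintegral_pathLaw (x : Fin (a + 1)) {f : (ℕ → Fin (a + 1)) → ℝ≥0∞} (hf : Measurable f) :
    ∫⁻ ω, f ω ∂X.pathLaw x = ∑ y : Fin (a + 1),
      ENNReal.ofReal (X.trans x y) * ∫⁻ ω, f (prepend x ω) ∂X.pathLaw y := by
  conv_lhs => rw [pathLaw_eq_sum]
  rw [lintegral_finsetSum_measure]
  refine Finset.sum_congr rfl fun y _ => ?_
  rw [lintegral_smul_measure, lintegral_map hf (measurable_prepend x), smul_eq_mul]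

lemma integral_pathLaw (x : Fin (a + 1)) {f : (ℕ → Fin (a + 1)) → ℂ} (hf : Measurable f)
    {C : ℝ} (hC : ∀ ω, ‖f ω‖ ≤ C) :
    ∫ ω, f ω ∂X.pathLaw x = ∑ y : Fin (a + 1),
      (X.trans x y) • ∫ ω, f (prepend x ω) ∂X.pathLaw y := by
  have hi : ∀ y, Integrable f ((X.pathLaw y).map (prepend x)) := fun y =>
    have : IsProbabilityMeasure ((X.pathLaw y).map (prepend x)) :=
      Measure.isProbabilityMeasure_map (measurable_prepend x).aemeasurable
    Integrable.of_bound hf.aestronglyMeasurable C (ae_of_all _ hC)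
  conv_lhs => rw [pathLaw_eq_sum]
  rw [integral_finsetSum_measure fun y _ => (hi y).smul_measure ENNReal.ofReal_ne_top]
  refine Finset.sum_congr rfl fun y _ => ?_
  rw [integral_smul_measure, integral_map (measurable_prepend x).aemeasurable
    hf.aestronglyMeasurable, ENNReal.toReal_ofReal (X.trans_nonneg (by omega) _)]

/-! ### Hitting times as functions of the path. -/

/-- An extended natural number is determined by the naturals that dominate it, so this property
characterises `hit`, the value `⊤` included. -/
lemma exists_hit_eq (H : Set (Fin (a + 1))) (ω : ℕ → Fin (a + 1)) :
    ∃ k : ℕ∞, hit H ω = (k : ℝ≥0∞) ∧ ∀ n : ℕ, k ≤ n ↔ ∃ j ≤ n, ω j ∈ H := by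
  refine ⟨_, rfl, fun n => ?_⟩
  have h := hittingAfter_le_iff (u := fun (t : ℕ) (ω : ℕ → Fin (a + 1)) => ω t) (s := H) (n := 0)
    (i := n) (ω := ω)
  refine h.trans (exists_congr fun j => ?_)
  rw [Set.mem_Icc]
  simp

lemma measurable_hit (H : Set (Fin (a + 1))) : Measurable (hit H) := by
  -- A countable infimum of measurable functions: time `n` costs `n` if the path is in `H` and `∞`
  -- otherwise.
  have : hit H = fun ω => ⨅ n : ℕ, (((fun ω : ℕ → Fin (a + 1) => ω n) ⁻¹' Hᶜ).indicator
      (fun _ => ⊤) ω + (n : ℝ≥0∞)) := by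
    funext ω
    obtain ⟨k, hk, hkn⟩ := exists_hit_eq H ω
    rw [hk]
    refine le_antisymm (le_iInf fun n => ?_) ?_
    · by_cases h : ω n ∈ H
      · rw [Set.indicator_of_notMem (by simpa using h), zero_add, ← ENat.toENNReal_coe,
          ENat.toENNReal_le]
        exact (hkn n).2 ⟨n, le_rfl, h⟩
      · rw [Set.indicator_of_mem (by simpa using h), top_add]
        exact le_top
    · induction k using ENat.recTopCoe with
      | top => simp
      | coe k =>
        obtain ⟨j, hj, hjH⟩ := (hkn k).1 le_rfl
        refine (iInf_le _ j).trans ?_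
        rw [Set.indicator_of_notMem (by simpa using hjH), zero_add, ENat.toENNReal_coe]
        exact_mod_cast hj
  rw [this]
  refine Measurable.iInf fun n => ?_
  refine (measurable_const.indicator ?_).add measurable_const
  exact measurable_pi_apply n (Set.toFinite Hᶜ).measurableSet

lemma hit_of_mem {H : Set (Fin (a + 1))} {ω : ℕ → Fin (a + 1)} (h : ω 0 ∈ H) : hit H ω = 0 := by
  obtain ⟨k, hk, hkn⟩ := exists_hit_eq H ω
  have := (hkn 0).2 ⟨0, le_rfl, h⟩
  rw [hk, show k = 0 by simpa using this, ENat.toENNReal_zero]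

lemma hit_prepend {H : Set (Fin (a + 1))} {x : Fin (a + 1)} (hx : x ∉ H)
    (ω : ℕ → Fin (a + 1)) : hit H (prepend x ω) = hit H ω + 1 := by
  obtain ⟨k, hk, h1⟩ := exists_hit_eq H (prepend x ω)
  obtain ⟨l, hl, h2⟩ := exists_hit_eq H ω
  have h3 : ∀ n : ℕ, k ≤ n ↔ l + 1 ≤ n := by
    intro n
    cases n with
    | zero =>
      rw [h1]
      simp [prepend, hx]
    | succ n =>
      rw [h1, Nat.cast_succ, ENat.add_le_add_iff_right ENat.one_ne_top, h2]
      constructor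
      · rintro ⟨j, hj, hjH⟩
        cases j with
        | zero => exact (hx hjH).elim
        | succ j => exact ⟨j, by omega, hjH⟩
      · rintro ⟨j, hj, hjH⟩
        exact ⟨j + 1, by omega, hjH⟩
  have h4 : k = l + 1 := by
    refine le_antisymm ?_ ?_
    · rcases eq_or_ne (l + 1) ⊤ with h | h
      · rw [h]; exact le_top
      · obtain ⟨n, hn⟩ := ENat.ne_top_iff_exists.1 h
        rw [← hn, h3, hn]
    · rcases eq_or_ne k ⊤ with h | h
      · rw [h]; exact le_top
      · obtain ⟨n, hn⟩ := ENat.ne_top_iff_exists.1 h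
        rw [← hn, ← h3, hn]
  rw [hk, hl, h4, ENat.toENNReal_add, ENat.toENNReal_one]

lemma ae_start (x : Fin (a + 1)) : ∀ᵐ ω ∂X.pathLaw x, ω 0 = x := by
  have h := X.pathLaw_cylinder x (fun _ => x) 0
  rw [if_pos rfl, Finset.range_zero, Finset.prod_empty] at h
  have hs : {ω : ℕ → Fin (a + 1) | ∀ t ≤ 0, ω t = x} = {ω | ω 0 = x} := by ext; simp
  rw [hs] at h
  rw [ae_iff]
  have hm : MeasurableSet {ω : ℕ → Fin (a + 1) | ω 0 = x} :=
    (measurableSet_singleton x).preimage (measurable_pi_apply 0)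
  exact (prob_compl_eq_zero_iff hm).2 h

/-! ### The generator, fluxes, and summation in closed form. -/

/-- Minus the generator of the chain, `1 - P`. -/
def gen {E : Type*} [AddCommGroup E] [Module ℝ E] (g : ℕ → E) (x : ℕ) : E :=
  X.p x • (g x - g (x + 1)) + X.q x • (g x - g (x - 1))

/-- The resistance `1 / (q_c π(c))` of the edge from `c - 1` to `c`. -/
noncomputable def res (c : ℕ) : ℝ := 1 / (X.q c * X.stat c)

/-- The mass `π({0, …, x - 1})`. -/
noncomputable def head (x : ℕ) : ℝ := ∑ y ∈ Finset.range x, X.stat y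

lemma head_add_tail {x : ℕ} (hx : x ≤ a + 1) : X.head x + X.tail x = 1 := by
  rw [← X.sum_stat, head, tail, Finset.range_eq_Ico, ← Finset.Ico_add_one_right_eq_Icc,
    ← Finset.Ico_add_one_right_eq_Icc, Finset.sum_Ico_consecutive _ (Nat.zero_le x) hx]

lemma res_pos {c : ℕ} (h1 : 1 ≤ c) (h2 : c ≤ a) : 0 < X.res c :=
  one_div_pos.2 (mul_pos (X.q_pos c h1 h2) (X.stat_pos h2))

lemma tail_pos {c : ℕ} (h : c ≤ a) : 0 < X.tail c :=
  Finset.sum_pos (fun _ hy => X.stat_pos (Finset.mem_Icc.1 hy).2) ⟨a, by simp [h]⟩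

lemma head_nonneg {c : ℕ} (h : c ≤ a + 1) : 0 ≤ X.head c :=
  Finset.sum_nonneg fun y hy => (X.stat_pos (by have := Finset.mem_range.1 hy; omega)).le

section gen

variable {E : Type*} [AddCommGroup E] [Module ℝ E]

/-- The boundary values are harmless: at `0` the truncated index `x - 1` comes with `q 0 = 0`, and
at `a` the value `g (a + 1)` comes with `p a = 0`. The target is a general real vector space so as
to serve both moments and complex characteristic functions. -/
lemma sum_trans_smul {x : ℕ} (hx : x ≤ a) (g : ℕ → E) :
    ∑ y : Fin (a + 1), X.trans x y • g y = g x - X.gen g x := by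
  rw [Fin.sum_univ_eq_sum_range (fun y => X.trans x y • g y) (a + 1)]
  have key : ∀ y : ℕ, X.trans x y • g y = (if x + 1 = y then X.p x • g y else 0)
      + (if x = y then (1 - X.p x - X.q x) • g y else 0)
      + (if x - 1 = y then X.q x • g y else 0) := by
    intro y
    rcases Nat.eq_zero_or_pos x with h | h
    · rw [h]
      rcases y with _ | _ | y <;> simp [trans, X.q_zero]
    · unfold trans
      split_ifs <;> first | omega | simp
  simp only [key, Finset.sum_add_distrib, Finset.sum_ite_eq, Finset.mem_range]
  rw [if_pos (by omega : x < a + 1), if_pos (by omega : x - 1 < a + 1), gen]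
  by_cases h : x + 1 < a + 1
  · rw [if_pos h]; module
  · have hxa : x = a := by omega
    rw [if_neg h, hxa, X.p_last]; module

/-- Detailed balance turns both terms into fluxes, one through each edge at `x`. Sums over intervals
then telescope, and the flux outside `{0, …, a}` vanishes at either end. -/
lemma stat_smul_gen {x : ℕ} (hx : x < a) (g : ℕ → E) :
    X.stat x • X.gen g x = (X.q (x + 1) * X.stat (x + 1)) • (g x - g (x + 1)) -
      (X.q x * X.stat x) • (g (x - 1) - g x) := by
  rw [mul_comm, ← X.stat_mul_p hx, gen]
  module

lemma stat_smul_gen_last (g : ℕ → E) :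
    X.stat a • X.gen g a = - ((X.q a * X.stat a) • (g (a - 1) - g a)) := by
  rw [gen, X.p_last]
  module

lemma sum_stat_smul_gen_range {x : ℕ} (hx : x < a) (g : ℕ → E) :
    ∑ y ∈ Finset.range (x + 1), X.stat y • X.gen g y =
      (X.q (x + 1) * X.stat (x + 1)) • (g x - g (x + 1)) := by
  induction x with
  | zero => simp [X.stat_smul_gen hx, X.q_zero]
  | succ x ih =>
    rw [Finset.sum_range_succ, ih (by omega), X.stat_smul_gen hx]
    simp

lemma sum_stat_smul_gen_Icc {x : ℕ} (hx : x ≤ a) (g : ℕ → E) :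
    ∑ y ∈ Finset.Icc x a, X.stat y • X.gen g y =
      (X.q x * X.stat x) • (g x - g (x - 1)) := by
  induction hx using Nat.decreasingInduction with
  | self =>
    rw [Finset.Icc_self, Finset.sum_singleton, stat_smul_gen_last]
    module
  | of_succ x hx ih =>
    rw [← Finset.sum_Ioc_add_eq_sum_Icc (by omega), ← Finset.Icc_add_one_left_eq_Ioc, ih,
      X.stat_smul_gen hx, Nat.add_sub_cancel]
    module

/-- Solving `(1 - P) g = r` on `{0, …, a - 1}` from the left. -/
lemma sub_eq_of_gen_eq_of_lt {g r : ℕ → E} (h : ∀ x < a, X.gen g x = r x) {x : ℕ} (hx : x < a) :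
    g x - g (x + 1) = X.res (x + 1) • ∑ y ∈ Finset.range (x + 1), X.stat y • r y := by
  have h1 : ∑ y ∈ Finset.range (x + 1), X.stat y • r y =
      ∑ y ∈ Finset.range (x + 1), X.stat y • X.gen g y :=
    Finset.sum_congr rfl fun y hy => by rw [h y (by have := Finset.mem_range.1 hy; omega)]
  rw [h1, X.sum_stat_smul_gen_range hx, smul_smul, res, one_div_mul_cancel, one_smul]
  exact (mul_pos (X.q_pos _ (by omega) hx) (X.stat_pos hx)).ne'

/-- Solving `(1 - P) g = r` on `{1, …, a}` from the right. -/
lemma sub_eq_of_gen_eq_of_pos {g r : ℕ → E} (h : ∀ x, 1 ≤ x → x ≤ a → X.gen g x = r x) {x : ℕ}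
    (h1 : 1 ≤ x) (hx : x ≤ a) :
    g x - g (x - 1) = X.res x • ∑ y ∈ Finset.Icc x a, X.stat y • r y := by
  have h2 : ∑ y ∈ Finset.Icc x a, X.stat y • r y =
      ∑ y ∈ Finset.Icc x a, X.stat y • X.gen g y :=
    Finset.sum_congr rfl fun y hy => by
      have := Finset.mem_Icc.1 hy
      rw [h y (by omega) this.2]
  rw [h2, X.sum_stat_smul_gen_Icc hx, smul_smul, res, one_div_mul_cancel, one_smul]
  exact (mul_pos (X.q_pos _ h1 hx) (X.stat_pos hx)).ne'

end gen

/-- Functions with the increments of a solution of `(1 - P) g = r` to the left of `b`. -/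
lemma gen_eq_of_sub_eq_left {g r : ℕ → ℝ} {x : ℕ} (hx : x < a)
    (h : ∀ y ≤ x, g y - g (y + 1) = X.res (y + 1) * ∑ z ∈ Finset.range (y + 1), X.stat z * r z) :
    X.gen g x = r x := by
  have hs := X.stat_pos hx.le
  have hq : ∀ y ≤ x, X.q (y + 1) * X.stat (y + 1) * (g y - g (y + 1)) =
      ∑ z ∈ Finset.range (y + 1), X.stat z * r z := by
    intro y hy
    have : X.q (y + 1) * X.stat (y + 1) ≠ 0 :=
      (mul_pos (X.q_pos _ (by omega) (by omega)) (X.stat_pos (by omega))).ne'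
    rw [h y hy, res, ← mul_assoc, mul_one_div_cancel this, one_mul]
  have h1 := X.stat_smul_gen hx g
  simp only [smul_eq_mul] at h1
  rw [hq x le_rfl, Finset.sum_range_succ] at h1
  have h2 : X.q x * X.stat x * (g (x - 1) - g x) = ∑ z ∈ Finset.range x, X.stat z * r z := by
    cases x with
    | zero => simp [X.q_zero]
    | succ x => simpa using hq x (by omega)
  rw [h2, add_sub_cancel_left] at h1
  exact mul_left_cancel₀ hs.ne' h1

lemma gen_eq_of_sub_eq_right {g r : ℕ → ℝ} {x : ℕ} (h1 : 1 ≤ x) (hx : x ≤ a)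
    (h : ∀ y, x ≤ y → y ≤ a →
      g y - g (y - 1) = X.res y * ∑ z ∈ Finset.Icc y a, X.stat z * r z) :
    X.gen g x = r x := by
  have hs := X.stat_pos hx
  have hq : ∀ y, x ≤ y → y ≤ a → X.q y * X.stat y * (g y - g (y - 1)) =
      ∑ z ∈ Finset.Icc y a, X.stat z * r z := by
    intro y hy hya
    have : X.q y * X.stat y ≠ 0 := (mul_pos (X.q_pos _ (by omega) hya) (X.stat_pos hya)).ne'
    rw [h y hy hya, res, ← mul_assoc, mul_one_div_cancel this, one_mul]
  refine mul_left_cancel₀ hs.ne' ?_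
  have h2 := hq x le_rfl hx
  rcases hx.lt_or_eq with hlt | rfl
  · have h3 := hq (x + 1) (by omega) hlt
    have h4 := X.stat_smul_gen hlt g
    rw [← Finset.sum_Ioc_add_eq_sum_Icc hx, ← Finset.Icc_add_one_left_eq_Ioc, ← h3] at h2
    simp only [smul_eq_mul, Nat.add_sub_cancel] at h4 h2
    linarith
  · have h4 := X.stat_smul_gen_last g
    simp only [smul_eq_mul, Finset.Icc_self, Finset.sum_singleton] at h4 h2
    linarith

/-! ### First-step analysis and bounds on moments. -/

lemma lintegral_comp_hit_of_mem (Φ : ℝ≥0∞ → ℝ≥0∞)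
    {H : Set (Fin (a + 1))} {x : Fin (a + 1)} (hx : x ∈ H) :
    ∫⁻ ω, Φ (hit H ω) ∂X.pathLaw x = Φ 0 := by
  have : ∀ᵐ ω ∂X.pathLaw x, Φ (hit H ω) = Φ 0 := by
    filter_upwards [X.ae_start x] with ω hω
    rw [hit_of_mem (by rwa [hω])]
  rw [lintegral_congr_ae this]
  simp

lemma lintegral_comp_hit {Φ : ℝ≥0∞ → ℝ≥0∞} (hΦ : Measurable Φ)
    {H : Set (Fin (a + 1))} {x : Fin (a + 1)} (hx : x ∉ H) :
    ∫⁻ ω, Φ (hit H ω) ∂X.pathLaw x = ∑ y : Fin (a + 1),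
      ENNReal.ofReal (X.trans x y) * ∫⁻ ω, Φ (hit H ω + 1) ∂X.pathLaw y := by
  rw [X.lintegral_pathLaw x (f := fun ω => Φ (hit H ω)) (hΦ.comp (measurable_hit H))]
  simp only [hit_prepend hx]

lemma sum_ofReal_trans_mul_ofReal (x : Fin (a + 1)) {W : ℕ → ℝ} (hW : ∀ y ≤ a, 0 ≤ W y) :
    ∑ y : Fin (a + 1), ENNReal.ofReal (X.trans x y) * ENNReal.ofReal (W y) =
      ENNReal.ofReal (W x - X.gen W x) := by
  have hx : (x : ℕ) ≤ a := by omega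
  rw [← X.sum_trans_smul hx W, ENNReal.ofReal_sum_of_nonneg]
  · refine Finset.sum_congr rfl fun y _ => ?_
    rw [smul_eq_mul, ENNReal.ofReal_mul (X.trans_nonneg hx _)]
  · exact fun y _ => mul_nonneg (X.trans_nonneg hx _) (hW _ (by omega))

/-- Monotone convergence reduces moments to truncated ones, which can be bounded by induction on the
level without knowing beforehand that they are finite. -/
lemma lintegral_hit_pow_eq_iSup (H : Set (Fin (a + 1))) (x : Fin (a + 1)) (k : ℕ) :
    ∫⁻ ω, hit H ω ^ k ∂X.pathLaw x =
      ⨆ n : ℕ, ∫⁻ ω, (min (hit H ω) n) ^ k ∂X.pathLaw x := by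
  rw [← lintegral_iSup]
  · refine lintegral_congr fun ω => ?_
    have hmono : Monotone fun n : ℕ => (min (hit H ω) n) ^ k := fun n m hnm => by
      dsimp only
      gcongr
    refine tendsto_nhds_unique ?_ (tendsto_atTop_iSup hmono)
    have h1 : Tendsto (fun n : ℕ => min (hit H ω) n) atTop (𝓝 (min (hit H ω) ⊤)) :=
      tendsto_const_nhds.min ENNReal.tendsto_nat_nhds_top
    rw [min_top_right] at h1
    exact ((ENNReal.continuous_pow k).tendsto _).comp h1
  · exact fun n => ((measurable_hit H).min measurable_const).pow_const k
  · intro n m hnm ω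
    dsimp only
    gcongr

/-- Supersolutions of the moment equations bound the first two moments of a hitting time. -/
lemma lintegral_hit_le {H : Set (Fin (a + 1))} {W V : ℕ → ℝ} (hW : ∀ y ≤ a, 0 ≤ W y)
    (hV : ∀ y ≤ a, 0 ≤ V y) (hW' : ∀ x : Fin (a + 1), x ∉ H → 1 ≤ X.gen W x)
    (hV' : ∀ x : Fin (a + 1), x ∉ H → 2 * W x ≤ X.gen V x) (x : Fin (a + 1)) :
    ∫⁻ ω, hit H ω ∂X.pathLaw x ≤ ENNReal.ofReal (W x) ∧
      ∫⁻ ω, hit H ω ^ 2 ∂X.pathLaw x ≤ ENNReal.ofReal (V x) := by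
  have hm : ∀ n : ℕ, Measurable fun t : ℝ≥0∞ => min t n := fun n =>
    measurable_id.min measurable_const
  have hm' : ∀ n : ℕ, Measurable fun ω => min (hit H ω) n := fun n =>
    (hm n).comp (measurable_hit H)
  have key : ∀ n : ℕ, ∀ x : Fin (a + 1),
      ∫⁻ ω, min (hit H ω) n ∂X.pathLaw x ≤ ENNReal.ofReal (W x) ∧
      ∫⁻ ω, (min (hit H ω) n) ^ 2 ∂X.pathLaw x ≤ ENNReal.ofReal (V x) := by
    intro n
    induction n with
    | zero => intro x; simp
    | succ n ih =>
      intro x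
      by_cases hx : x ∈ H
      · rw [X.lintegral_comp_hit_of_mem (fun t => min t ((n + 1 : ℕ) : ℝ≥0∞)) hx,
          X.lintegral_comp_hit_of_mem (fun t => (min t ((n + 1 : ℕ) : ℝ≥0∞)) ^ 2) hx]
        simp
      -- One step of the chain lowers the truncation level by exactly one, which is what drives the
      -- induction.
      · have hmin : ∀ t : ℝ≥0∞, min (t + 1) ((n + 1 : ℕ) : ℝ≥0∞) = min t n + 1 := fun t => by
          rw [Nat.cast_succ, min_add_add_right]
        have hWx := hW x (by omega)
        constructor
        · rw [X.lintegral_comp_hit (hm (n + 1)) hx]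
          simp only [hmin]
          have : ∀ y : Fin (a + 1), ∫⁻ ω, (min (hit H ω) n + 1) ∂X.pathLaw y ≤
              ENNReal.ofReal (W y + 1) := by
            intro y
            rw [lintegral_add_right _ measurable_const,
              ENNReal.ofReal_add (hW y (by omega)) zero_le_one]
            simpa using (ih y).1
          refine (Finset.sum_le_sum fun y _ => mul_le_mul_right (this y) _).trans ?_
          rw [X.sum_ofReal_trans_mul_ofReal x (W := fun y => W y + 1)
            fun y hy => by linarith [hW y hy]]
          refine ENNReal.ofReal_le_ofReal ?_
          have := hW' x hx
          simp only [gen, smul_eq_mul] at this ⊢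
          linarith
        · rw [X.lintegral_comp_hit (Φ := fun t => (min t ((n + 1 : ℕ) : ℝ≥0∞)) ^ 2)
            ((hm (n + 1)).pow_const 2) hx]
          simp only [hmin]
          have : ∀ y : Fin (a + 1), ∫⁻ ω, (min (hit H ω) n + 1) ^ 2 ∂X.pathLaw y ≤
              ENNReal.ofReal (V y + 2 * W y + 1) := by
            intro y
            have h1 : ∀ ω, (min (hit H ω) n + 1) ^ 2 =
                (min (hit H ω) n) ^ 2 + 2 * min (hit H ω) n + 1 := fun ω => by ring
            simp only [h1]
            rw [lintegral_add_right _ measurable_const,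
              lintegral_add_right _ ((hm' n).const_mul 2), lintegral_const_mul _ (hm' n),
              ENNReal.ofReal_add (by linarith [hW y (by omega), hV y (by omega)]) zero_le_one,
              ENNReal.ofReal_add (hV y (by omega)) (by linarith [hW y (by omega)]),
              ENNReal.ofReal_mul zero_le_two]
            have h2 := (ih y).1
            have h3 := (ih y).2
            simp only [lintegral_const, measure_univ, mul_one, ENNReal.ofReal_one,
              ENNReal.ofReal_ofNat]
            gcongr
          refine (Finset.sum_le_sum fun y _ => mul_le_mul_right (this y) _).trans ?_
          rw [X.sum_ofReal_trans_mul_ofReal x (W := fun y => V y + 2 * W y + 1)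
            fun y hy => by linarith [hW y hy, hV y hy]]
          -- `P(V + 2W + 1) ≤ (V - 2W) + 2(W - 1) + 1 = V - 1`, so there is room to spare.
          refine ENNReal.ofReal_le_ofReal ?_
          have h1 := hW' x hx
          have h2 := hV' x hx
          simp only [gen, smul_eq_mul] at h1 h2 ⊢
          linarith
  constructor
  · have h := X.lintegral_hit_pow_eq_iSup H x 1
    simp only [pow_one] at h
    rw [h]
    exact iSup_le fun n => (key n x).1
  · rw [X.lintegral_hit_pow_eq_iSup H x 2]
    exact iSup_le fun n => (key n x).2

/-! ### Explicit mean hitting times. -/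

/-- The mean time from `x` to `z`. -/
noncomputable def hitSum (z x : ℕ) : ℝ :=
  ∑ c ∈ Finset.Ioc x z, X.res c * X.head c + ∑ c ∈ Finset.Ioc z x, X.res c * X.tail c

lemma hitSum_nonneg {z x : ℕ} (hz : z ≤ a) (hx : x ≤ a) : 0 ≤ X.hitSum z x := by
  refine add_nonneg (Finset.sum_nonneg fun c hc => ?_) (Finset.sum_nonneg fun c hc => ?_) <;>
    have hc := Finset.mem_Ioc.1 hc
  · exact mul_nonneg (X.res_pos (by omega) (by omega)).le (X.head_nonneg (by omega))
  · exact mul_nonneg (X.res_pos (by omega) (by omega)).le (X.tail_pos (by omega)).le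

lemma hitSum_self (z : ℕ) : X.hitSum z z = 0 := by simp [hitSum]

/-- On each side of `z` only one of the two sums varies, and its increments are those of the
solution with `r = 1`. -/
lemma gen_hitSum {z x : ℕ} (hz : z ≤ a) (hx : x ≤ a) (hxz : x ≠ z) :
    X.gen (X.hitSum z) x = 1 := by
  rcases hxz.lt_or_gt with h | h
  · refine X.gen_eq_of_sub_eq_left (r := fun _ => 1) (by omega) fun y hy => ?_
    have h1 : Finset.Ioc z y = ∅ := Finset.Ioc_eq_empty (by omega)
    have h2 : Finset.Ioc z (y + 1) = ∅ := Finset.Ioc_eq_empty (by omega)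
    have h3 : Finset.Ioc y z = insert (y + 1) (Finset.Ioc (y + 1) z) := by
      ext; simp only [Finset.mem_Ioc, Finset.mem_insert]; omega
    rw [hitSum, hitSum, h1, h2, h3, Finset.sum_insert (by simp), head]
    simp
  · refine X.gen_eq_of_sub_eq_right (r := fun _ => 1) (by omega) hx fun y hy hya => ?_
    obtain ⟨y, rfl⟩ : ∃ k, y = k + 1 := ⟨y - 1, by omega⟩
    have h1 : Finset.Ioc (y + 1) z = ∅ := Finset.Ioc_eq_empty (by omega)
    have h2 : Finset.Ioc y z = ∅ := Finset.Ioc_eq_empty (by omega)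
    rw [hitSum, hitSum, Nat.add_sub_cancel, h1, h2, Finset.sum_Ioc_succ_top (by omega), tail]
    simp

/-- A multiple of the mean serves as supersolution for the second moment: `(1 - P)(2m h) = 2m ≥ 2h`
off `z`, where `h = hitSum z`. -/
lemma lintegral_hit_singleton_le {z : Fin (a + 1)} {m : ℝ} (hm : ∀ y ≤ a, X.hitSum z y ≤ m)
    (x : Fin (a + 1)) :
    X.meanHit x {z} ≤ ENNReal.ofReal (X.hitSum z x) ∧
      ∫⁻ ω, hit {z} ω ^ 2 ∂X.pathLaw x ≤ ENNReal.ofReal (2 * m * X.hitSum z x) := by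
  have hz : (z : ℕ) ≤ a := by omega
  have hne : ∀ x : Fin (a + 1), x ∉ ({z} : Set (Fin (a + 1))) → X.gen (X.hitSum z) x = 1 :=
    fun x hx => X.gen_hitSum hz (by omega) fun h => hx (Fin.ext h)
  have hm0 : 0 ≤ m := (X.hitSum_nonneg hz (Nat.zero_le a)).trans (hm 0 (Nat.zero_le a))
  refine X.lintegral_hit_le (W := X.hitSum z) (V := fun y => 2 * m * X.hitSum z y)
    (fun y hy => X.hitSum_nonneg hz hy)
    (fun y hy => mul_nonneg (by positivity) (X.hitSum_nonneg hz hy))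
    (fun x hx => (hne x hx).ge) (fun x hx => ?_) x
  have h1 := hne x hx
  have h2 := hm x (by omega)
  have h3 : X.gen (fun y => 2 * m * X.hitSum z y) x = 2 * m * X.gen (X.hitSum z) x := by
    simp only [gen, smul_eq_mul]; ring
  rw [h3, h1]
  linarith

lemma meanHit_le (x z : Fin (a + 1)) : X.meanHit x {z} ≤ ENNReal.ofReal (X.hitSum z x) :=
  -- Any upper bound for `hitSum` would do as `m`, since only the first moment is used.
  (X.lintegral_hit_singleton_le (m := ∑ y ∈ Finset.range (a + 1), X.hitSum z y)
    (fun y hy => Finset.single_le_sum (f := X.hitSum z)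
      (fun i hi => X.hitSum_nonneg (by omega) (by have := Finset.mem_range.1 hi; omega))
      (Finset.mem_range.2 (by omega))) x).1

lemma meanHit_lt_top (x z : Fin (a + 1)) : X.meanHit x {z} < ∞ :=
  (X.meanHit_le x z).trans_lt ENNReal.ofReal_lt_top

lemma meanHit_self (z : Fin (a + 1)) : X.meanHit z {z} = 0 :=
  X.lintegral_comp_hit_of_mem (fun t => t) rfl

/-- Finiteness, already known from the supersolution, allows the first-step equation to be read in
`ℝ`. `Fin.ofNat` wraps `a + 1` round to `0`, but that value is multiplied by `p a = 0`. -/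
lemma gen_toReal_meanHit {x z : Fin (a + 1)} (hxz : x ≠ z) :
    X.gen (fun n => (X.meanHit (Fin.ofNat (a + 1) n) {z}).toReal) x = 1 := by
  have h1 := X.lintegral_comp_hit (Φ := fun t => t) measurable_id (H := {z}) (x := x) (by simpa)
  have h2 : ∀ y, ∫⁻ ω, (hit {z} ω + 1) ∂X.pathLaw y = X.meanHit y {z} + 1 := fun y => by
    rw [lintegral_add_right _ measurable_const]
    simp [meanHit]
  have h3 : ∀ y, X.meanHit y {z} ≠ ∞ := fun y => (X.meanHit_lt_top y z).ne
  simp only [h2] at h1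
  have h4 := congrArg ENNReal.toReal h1
  rw [ENNReal.toReal_sum fun y _ => ENNReal.mul_ne_top ENNReal.ofReal_ne_top (by simp [h3])] at h4
  have h5 := X.sum_trans_smul (x := x) (by omega)
    (fun n => (X.meanHit (Fin.ofNat (a + 1) n) {z}).toReal)
  have h6 : ∀ y : Fin (a + 1), Fin.ofNat (a + 1) (y : ℕ) = y := fun y => by simp
  simp only [h6, smul_eq_mul] at h5
  have h7 : ∀ y : Fin (a + 1), (ENNReal.ofReal (X.trans x y) * (X.meanHit y {z} + 1)).toReal =
      X.trans x y * (X.meanHit y {z}).toReal + X.trans x y := fun y => by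
    rw [ENNReal.toReal_mul, ENNReal.toReal_ofReal (X.trans_nonneg (by omega) _),
      ENNReal.toReal_add (h3 y) ENNReal.one_ne_top, ENNReal.toReal_one]
    ring
  simp only [h7, Finset.sum_add_distrib, h5, X.sum_trans] at h4
  change (X.meanHit x {z}).toReal = _ at h4
  linarith

/-- The mean and `hitSum a` solve the same equation on `{0, …, a - 1}`. Since `q 0 = 0`, that
equation determines all increments, and both functions vanish at `a`. -/
lemma meanHit_last (x : Fin (a + 1)) :
    X.meanHit x {Fin.last a} = ENNReal.ofReal (X.hitSum a x) := by
  set v : ℕ → ℝ := fun n => (X.meanHit (Fin.ofNat (a + 1) n) {Fin.last a}).toReal with hv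
  have hval : ∀ n ≤ a, ((Fin.ofNat (a + 1) n : Fin (a + 1)) : ℕ) = n := fun n hn => by
    simp [Nat.mod_eq_of_lt (Nat.lt_succ_of_le hn)]
  have h1 : ∀ n < a, X.gen v n = 1 := fun n hn => by
    have := X.gen_toReal_meanHit (x := Fin.ofNat (a + 1) n) (z := Fin.last a) fun h => by
      have := congrArg Fin.val h
      rw [hval n hn.le, Fin.val_last] at this
      omega
    rwa [hval n hn.le] at this
  have h2 : ∀ n ≤ a, v n = X.hitSum a n := fun n hn => by
    induction hn using Nat.decreasingInduction with
    | self =>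
      rw [hitSum_self, hv]
      simp [meanHit_self]
    | of_succ n hn ih =>
      have h3 := X.sub_eq_of_gen_eq_of_lt (r := fun _ => 1) h1 hn
      have h4 := X.sub_eq_of_gen_eq_of_lt (g := X.hitSum a) (r := fun _ => 1)
        (fun n hn => X.gen_hitSum le_rfl hn.le hn.ne) hn
      linarith
  rw [← h2 x (by omega), hv]
  simp only [Fin.ofNat_val_eq_self]
  rw [ENNReal.ofReal_toReal (X.meanHit_lt_top _ _).ne]

lemma meanHit_zero (x : Fin (a + 1)) :
    X.meanHit x {0} = ENNReal.ofReal (X.hitSum 0 x) := by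
  set v : ℕ → ℝ := fun n => (X.meanHit (Fin.ofNat (a + 1) n) {0}).toReal with hv
  have hval : ∀ n ≤ a, ((Fin.ofNat (a + 1) n : Fin (a + 1)) : ℕ) = n := fun n hn => by
    simp [Nat.mod_eq_of_lt (Nat.lt_succ_of_le hn)]
  have h1 : ∀ n, 1 ≤ n → n ≤ a → X.gen v n = 1 := fun n hn1 hn => by
    have := X.gen_toReal_meanHit (x := Fin.ofNat (a + 1) n) (z := 0) fun h => by
      have := congrArg Fin.val h
      rw [hval n hn, Fin.val_zero] at this
      omega
    rwa [hval n hn] at this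
  have h2 : ∀ n ≤ a, v n = X.hitSum 0 n := fun n hn => by
    induction n with
    | zero =>
      rw [hitSum_self, hv]
      simp [meanHit_self]
    | succ n ih =>
      have h3 := X.sub_eq_of_gen_eq_of_pos (r := fun _ => 1) h1 (Nat.le_add_left 1 n) hn
      have h4 := X.sub_eq_of_gen_eq_of_pos (g := X.hitSum 0) (r := fun _ => 1)
        (fun n hn hna => X.gen_hitSum (Nat.zero_le a) hna (by omega)) (Nat.le_add_left 1 n) hn
      have h5 := ih (by omega)
      simp only [Nat.add_sub_cancel] at h3 h4
      linarith
  rw [← h2 x (by omega), hv]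
  simp only [Fin.ofNat_val_eq_self]
  rw [ENNReal.ofReal_toReal (X.meanHit_lt_top _ _).ne]

lemma hitSum_last_eq (x : ℕ) (hx : x ≤ a) :
    X.hitSum a x = ∑ c ∈ Finset.Ioc x a, X.res c * X.head c := by
  rw [hitSum, Finset.Ioc_eq_empty (by omega : ¬ a < x)]
  simp

lemma hitSum_zero_eq (x : ℕ) :
    X.hitSum 0 x = ∑ c ∈ Finset.Ioc 0 x, X.res c * X.tail c := by
  simp [hitSum]

lemma hitSum_last_le {x : ℕ} (hx : x ≤ a) : X.hitSum a x ≤ X.hitSum a 0 := by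
  rw [X.hitSum_last_eq x hx, X.hitSum_last_eq 0 (Nat.zero_le a)]
  refine Finset.sum_le_sum_of_subset_of_nonneg (Finset.Ioc_subset_Ioc_left (Nat.zero_le x))
    fun c hc _ => ?_
  have := Finset.mem_Ioc.1 hc
  exact mul_nonneg (X.res_pos (by omega) (by omega)).le (X.head_nonneg (by omega))

lemma hitSum_zero_le {x : ℕ} (hx : x ≤ a) : X.hitSum 0 x ≤ X.hitSum 0 a := by
  rw [hitSum_zero_eq, hitSum_zero_eq]
  refine Finset.sum_le_sum_of_subset_of_nonneg (Finset.Ioc_subset_Ioc_right hx)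
    fun c hc _ => ?_
  have := Finset.mem_Ioc.1 hc
  exact mul_nonneg (X.res_pos (by omega) (by omega)).le (X.tail_pos (by omega)).le

lemma hitSum_zero_pos (ha : 1 ≤ a) : 0 < X.hitSum 0 a := by
  rw [hitSum_zero_eq]
  refine Finset.sum_pos (fun c hc => ?_) ⟨a, Finset.mem_Ioc.2 ⟨ha, le_rfl⟩⟩
  have := Finset.mem_Ioc.1 hc
  exact mul_pos (X.res_pos (by omega) (by omega)) (X.tail_pos (by omega))

/-- Each summand is at least `1`: by detailed balance `res c = 1/(π(c-1) p_{c-1})`, while `head c ≥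
π(c-1)` and `p_{c-1} ≤ 1`. This makes the mean tend to infinity with `a`. -/
lemma le_hitSum_last : (a : ℝ) ≤ X.hitSum a 0 := by
  rw [X.hitSum_last_eq 0 (Nat.zero_le a)]
  have : (a : ℝ) = ∑ c ∈ Finset.Ioc 0 a, (1 : ℝ) := by simp
  rw [this]
  refine Finset.sum_le_sum fun c hc => ?_
  have hc := Finset.mem_Ioc.1 hc
  obtain ⟨x, rfl⟩ : ∃ x, c = x + 1 := ⟨c - 1, by omega⟩
  have hx : x < a := by omega
  have hp := X.p_pos x hx
  have hs := X.stat_pos hx.le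
  have hp1 : X.p x ≤ 1 := by linarith [X.add_le_one x hx.le, X.q_nonneg hx.le]
  have hh : X.stat x ≤ X.head (x + 1) := by
    rw [head, Finset.sum_range_succ]
    exact le_add_of_nonneg_left (X.head_nonneg (c := x) (by omega))
  rw [res, mul_comm (X.q _), ← mul_comm (X.q _), mul_comm (X.q _), ← X.stat_mul_p hx,
    one_div_mul_eq_div, one_le_div (mul_pos hs hp)]
  nlinarith

/-- The commute-time identity: the mean times from `0` to `a` and back add up to the total
resistance, because `head + tail = 1`. -/
lemma sum_res_sub : X.hitSum a 0 = ∑ c ∈ Finset.Ioc 0 a, X.res c - X.hitSum 0 a := by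
  rw [X.hitSum_last_eq 0 (Nat.zero_le a), hitSum_zero_eq, ← Finset.sum_sub_distrib]
  refine Finset.sum_congr rfl fun c hc => ?_
  have := X.head_add_tail (x := c) (by have := Finset.mem_Ioc.1 hc; omega)
  linear_combination X.res c * this

/-! ### The quantities `Q` and the second moment of the time to `0`. -/

lemma tail_mul_Q {x : ℕ} (hx : x ≤ a) :
    X.tail x * X.Q x = ∑ c ∈ Finset.Icc x a, X.res c * X.tail c ^ 2 := by
  rw [Q, ← mul_assoc, mul_one_div_cancel (X.tail_pos hx).ne', one_mul]
  refine Finset.sum_congr rfl fun c _ => ?_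
  rw [res]; ring

lemma Q_nonneg {x : ℕ} (hx1 : 1 ≤ x) (hx : x ≤ a) : 0 ≤ X.Q x := by
  refine nonneg_of_mul_nonneg_right (b := X.Q x) ?_ (X.tail_pos hx)
  rw [X.tail_mul_Q hx]
  refine Finset.sum_nonneg fun c hc => ?_
  have := Finset.mem_Icc.1 hc
  exact mul_nonneg (X.res_pos (by omega) this.2).le (sq_nonneg _)

lemma Q_le_supQ {x : ℕ} (hx1 : 1 ≤ x) (hx : x ≤ a) : X.Q x ≤ X.supQ :=
  le_csSup ((Set.finite_Icc 1 a).image _).bddAbove ⟨x, ⟨hx1, hx⟩, rfl⟩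

/-- Cauchy–Schwarz for `res * tail = (√res * tail) * √res`. -/
lemma hitSum_zero_sq_le (ha : 1 ≤ a) :
    X.hitSum 0 a ^ 2 ≤ (X.tail 1 * X.Q 1) * ∑ c ∈ Finset.Ioc 0 a, X.res c := by
  have hI : Finset.Icc 1 a = Finset.Ioc 0 a := rfl
  rw [X.tail_mul_Q ha, hI, hitSum_zero_eq]
  refine Finset.sum_sq_le_sum_mul_sum_of_sq_le_mul _ (fun c hc => ?_) (fun c hc => ?_)
    fun c hc => le_of_eq (by ring)
  all_goals have := Finset.mem_Ioc.1 hc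
  · exact mul_nonneg (X.res_pos (by omega) this.2).le (sq_nonneg _)
  · exact (X.res_pos (by omega) this.2).le

lemma tail_eq_add {x : ℕ} (hx : x ≤ a) : X.tail x = X.stat x + X.tail (x + 1) := by
  rw [tail, ← Finset.sum_Ioc_add_eq_sum_Icc hx, ← Finset.Icc_add_one_left_eq_Ioc, tail, add_comm]

lemma hitSum_zero_succ (x : ℕ) :
    X.hitSum 0 (x + 1) = X.hitSum 0 x + X.res (x + 1) * X.tail (x + 1) := by
  rw [hitSum_zero_eq, hitSum_zero_eq, Finset.sum_Ioc_succ_top (Nat.zero_le x)]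

/-- Summation by parts: the increment `res d * tail d` of `hitSum 0` is felt by all states from `d`
on, which contributes a second factor `tail d`. -/
lemma sum_stat_mul_hitSum_zero {x : ℕ} (hx : x ≤ a) :
    ∑ y ∈ Finset.Icc x a, X.stat y * X.hitSum 0 y =
      X.tail x * X.hitSum 0 x + ∑ d ∈ Finset.Ioc x a, X.res d * X.tail d ^ 2 := by
  induction hx using Nat.decreasingInduction with
  | self => simp [tail]
  | of_succ x hx ih =>
    rw [← Finset.sum_Ioc_add_eq_sum_Icc hx.le, ← Finset.Icc_add_one_left_eq_Ioc, ih,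
      Finset.Icc_add_one_left_eq_Ioc,
      ← Finset.Icc_add_one_left_eq_Ioc x a,
      ← Finset.sum_Ioc_add_eq_sum_Icc (show x + 1 ≤ a from hx), X.tail_eq_add hx.le,
      hitSum_zero_succ]
    ring

/-- Half the second moment of the time from `x` to `0`, up to the mean. -/
noncomputable def hitSqSum (x : ℕ) : ℝ :=
  ∑ c ∈ Finset.Ioc 0 x, X.res c * ∑ y ∈ Finset.Icc c a, X.stat y * X.hitSum 0 y

lemma hitSqSum_nonneg {x : ℕ} (hx : x ≤ a) : 0 ≤ X.hitSqSum x := by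
  refine Finset.sum_nonneg fun c hc => ?_
  have := Finset.mem_Ioc.1 hc
  refine mul_nonneg (X.res_pos (by omega) (by omega)).le (Finset.sum_nonneg fun y hy => ?_)
  have := Finset.mem_Icc.1 hy
  exact mul_nonneg (X.stat_pos this.2).le (X.hitSum_nonneg (Nat.zero_le a) this.2)

lemma gen_hitSqSum {x : ℕ} (h1 : 1 ≤ x) (hx : x ≤ a) : X.gen X.hitSqSum x = X.hitSum 0 x := by
  refine X.gen_eq_of_sub_eq_right h1 hx fun y hy hya => ?_
  obtain ⟨y, rfl⟩ : ∃ k, y = k + 1 := ⟨y - 1, by omega⟩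
  rw [Nat.add_sub_cancel, hitSqSum, hitSqSum, Finset.sum_Ioc_succ_top (Nat.zero_le y)]
  ring

/-- With `h = hitSum 0` and `δ = res c * tail c`, the increment of `hitSqSum` at `c` is `δ h(c) +
res c * ∑_{d>c} res d * tail d ^ 2`. The last term equals `δ Q(c) - δ²`, and `2δ h(c) - δ²` is the
increment of `h²`. -/
lemma two_mul_hitSqSum_le {x : ℕ} (hx : x ≤ a) :
    2 * X.hitSqSum x ≤ X.hitSum 0 x ^ 2 + 2 * X.supQ * X.hitSum 0 x := by
  induction x with
  | zero => simp [hitSqSum, hitSum]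
  | succ x ih =>
    have h0 := ih (by omega)
    have hw := X.res_pos (Nat.le_add_left 1 x) hx
    have ht := X.tail_pos hx
    have h1 := X.tail_mul_Q hx
    have h2 := X.Q_le_supQ (Nat.le_add_left 1 x) hx
    rw [← Finset.sum_Ioc_add_eq_sum_Icc hx] at h1
    have h3 : X.hitSqSum (x + 1) = X.hitSqSum x + X.res (x + 1) *
        (X.tail (x + 1) * X.hitSum 0 (x + 1) +
          ∑ d ∈ Finset.Ioc (x + 1) a, X.res d * X.tail d ^ 2) := by
      rw [← X.sum_stat_mul_hitSum_zero hx, hitSqSum, hitSqSum,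
        Finset.sum_Ioc_succ_top (Nat.zero_le x)]
    have h4 : X.res (x + 1) * (X.tail (x + 1) * X.Q (x + 1)) ≤
        X.res (x + 1) * (X.tail (x + 1) * X.supQ) := by gcongr
    rw [h3, X.hitSum_zero_succ]
    rw [h1] at h4
    -- The two sides differ by at least the square `δ²`.
    nlinarith [sq_nonneg (X.res (x + 1) * X.tail (x + 1))]

lemma lintegral_hit_zero_sq_le :
    ∫⁻ ω, hit {0} ω ^ 2 ∂X.pathLaw (Fin.last a) ≤
      ENNReal.ofReal (X.hitSum 0 a ^ 2 + 2 * X.supQ * X.hitSum 0 a) := by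
  refine (X.lintegral_hit_le (H := {0}) (W := X.hitSum 0) (V := fun y => 2 * X.hitSqSum y)
    (fun y hy => X.hitSum_nonneg (Nat.zero_le a) hy)
    (fun y hy => mul_nonneg zero_le_two (X.hitSqSum_nonneg hy)) (fun x hx => ?_) (fun x hx => ?_)
    (Fin.last a)).2.trans (ENNReal.ofReal_le_ofReal (X.two_mul_hitSqSum_le le_rfl))
  · exact (X.gen_hitSum (Nat.zero_le a) (by omega) fun h => hx (Fin.ext h)).ge
  · have h1 : (x : ℕ) ≠ 0 := fun h => hx (Fin.ext h)
    have h2 := X.gen_hitSqSum (x := x) (by omega) (by omega)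
    have h3 : X.gen (fun y => 2 * X.hitSqSum y) x = 2 * X.gen X.hitSqSum x := by
      simp only [gen, smul_eq_mul]; ring
    rw [h3, h2]

/-! ### The characteristic function of the time from `0` to `a`. -/

lemma ae_hit_lt_top (x z : Fin (a + 1)) : ∀ᵐ ω ∂X.pathLaw x, hit {z} ω < ∞ :=
  ae_lt_top (measurable_hit _) (X.meanHit_lt_top x z).ne

/-- The characteristic function at `θ` of the hitting time of `z` from `x`. -/
noncomputable def hitChar (z x : Fin (a + 1)) (θ : ℝ) : ℂ :=
  ∫ ω, Complex.exp (θ * (hit {z} ω).toReal * Complex.I) ∂X.pathLaw x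

lemma norm_exp_mul_mul_I (θ t : ℝ) : ‖Complex.exp (θ * t * Complex.I)‖ = 1 := by
  rw [← Complex.ofReal_mul, Complex.norm_exp_ofReal_mul_I]

lemma norm_hitChar_le (z x : Fin (a + 1)) (θ : ℝ) : ‖X.hitChar z x θ‖ ≤ 1 := by
  refine (norm_integral_le_of_norm_le_const (C := 1)
    (ae_of_all _ fun ω => (norm_exp_mul_mul_I θ _).le)).trans ?_
  simp

lemma hitChar_self (z : Fin (a + 1)) (θ : ℝ) : X.hitChar z z θ = 1 := by
  have : ∀ᵐ ω ∂X.pathLaw z, Complex.exp (θ * (hit {z} ω).toReal * Complex.I) = 1 := by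
    filter_upwards [X.ae_start z] with ω hω
    rw [hit_of_mem (by simp [hω])]
    simp
  rw [hitChar, integral_congr_ae this]
  simp

lemma hitChar_eq_sum {z x : Fin (a + 1)} (hxz : x ≠ z) (θ : ℝ) :
    X.hitChar z x θ = Complex.exp (θ * Complex.I) *
      ∑ y : Fin (a + 1), X.trans x y • X.hitChar z y θ := by
  have hm : Measurable fun ω : ℕ → Fin (a + 1) =>
      Complex.exp (θ * (hit {z} ω).toReal * Complex.I) := by
    have := (measurable_hit ({z} : Set (Fin (a + 1)))).ennreal_toReal
    fun_prop
  rw [hitChar, X.integral_pathLaw x hm (C := 1) fun ω => (norm_exp_mul_mul_I θ _).le,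
    Finset.mul_sum]
  refine Finset.sum_congr rfl fun y _ => ?_
  rw [hitChar, mul_smul_comm, ← integral_const_mul]
  congr 1
  refine integral_congr_ae ?_
  -- Almost sure finiteness is needed here: `toReal` would not turn `∞ + 1` into a sum.
  filter_upwards [X.ae_hit_lt_top y z] with ω hω
  rw [hit_prepend (by simpa using hxz), ENNReal.toReal_add hω.ne ENNReal.one_ne_top,
    ENNReal.toReal_one, ← Complex.exp_add]
  congr 1
  push_cast
  ring

/-- Comparison of the characteristic function of the hitting time of the last state with that
of a geometric time. -/
lemma norm_hitChar_last_sub_le (θ : ℝ) :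
    ‖X.hitChar (Fin.last a) 0 θ - 1 -
        (1 - Complex.exp (-(θ * Complex.I))) * X.hitSum a 0 * X.hitChar (Fin.last a) 0 θ‖ ≤
      θ ^ 2 * ((∑ c ∈ Finset.Ioc 0 a, X.res c) * X.hitSum 0 a) := by
  set κ : ℂ := 1 - Complex.exp (-(θ * Complex.I)) with hκ
  have hκn : ‖κ‖ ≤ |θ| := by
    have := Real.norm_exp_I_mul_ofReal_sub_one_le (x := -θ)
    rw [norm_neg, Real.norm_eq_abs] at this
    rw [hκ, norm_sub_rev]
    refine le_trans (le_of_eq ?_) this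
    congr 3
    push_cast
    ring
  set g : ℕ → ℂ := fun n => X.hitChar (Fin.last a) (Fin.ofNat (a + 1) n) θ with hg
  have hval : ∀ n ≤ a, ((Fin.ofNat (a + 1) n : Fin (a + 1)) : ℕ) = n := fun n hn => by
    simp [Nat.mod_eq_of_lt (Nat.lt_succ_of_le hn)]
  -- The first-step equation, multiplied by `exp(-iθ)`, becomes an eigenvalue equation for `1 - P`
  -- off the last state.
  have hgen : ∀ n < a, X.gen g n = κ * g n := by
    intro n hn
    have h1 := X.hitChar_eq_sum (x := Fin.ofNat (a + 1) n) (z := Fin.last a) (fun h => by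
      have := congrArg Fin.val h
      rw [hval n hn.le, Fin.val_last] at this
      omega) θ
    have h2 := X.sum_trans_smul hn.le g
    rw [hval n hn.le] at h1
    have h3 : ∀ y : Fin (a + 1), g y = X.hitChar (Fin.last a) y θ := fun y => by simp [hg]
    simp only [h3] at h2
    rw [h2] at h1
    change g n = _ at h1
    have h4 : Complex.exp (-(θ * Complex.I)) * g n = g n - X.gen g n := by
      conv_lhs => rw [h1]
      rw [← mul_assoc, ← Complex.exp_add]
      simp
    rw [hκ, sub_mul, one_mul, h4]
    ring
  have hgn : ∀ n, ‖g n‖ ≤ 1 := fun n => X.norm_hitChar_le _ _ θ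
  have hga : g a = 1 := by
    have : (Fin.ofNat (a + 1) a) = Fin.last a := Fin.ext (hval a le_rfl)
    rw [hg]
    simp only [this]
    exact X.hitChar_self _ θ
  have hg0 : g 0 = X.hitChar (Fin.last a) 0 θ := by simp [hg]
  rw [← hg0]
  have hstep : ∀ n < a, g n - g (n + 1) =
      X.res (n + 1) • ∑ y ∈ Finset.range (n + 1), X.stat y • (κ * g y) := fun n hn =>
    X.sub_eq_of_gen_eq_of_lt hgen hn
  -- Since `|κ| ≤ |θ|` and `|g| ≤ 1`, the increments of `g` are at most `|θ|` times those of the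
  -- mean time.
  have hdist : ∀ n ≤ a, ‖g n - g 0‖ ≤ |θ| * ∑ c ∈ Finset.Ioc 0 n, X.res c * X.head c := by
    intro n hn
    induction n with
    | zero => simp
    | succ n ih =>
      have h1 : ‖g n - g (n + 1)‖ ≤ |θ| * (X.res (n + 1) * X.head (n + 1)) := by
        rw [hstep n hn, norm_smul, Real.norm_of_nonneg (X.res_pos (by omega) hn).le,
          mul_left_comm]
        refine mul_le_mul_of_nonneg_left ?_ (X.res_pos (by omega) hn).le
        rw [head, Finset.mul_sum]
        refine norm_sum_le_of_le _ fun y hy => ?_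
        have hs := X.stat_pos (x := y) (by have := Finset.mem_range.1 hy; omega)
        rw [norm_smul, Real.norm_of_nonneg hs.le, mul_comm, norm_mul]
        have : ‖κ‖ * ‖g y‖ ≤ |θ| * 1 := by gcongr; exact hgn y
        nlinarith
      rw [Finset.sum_Ioc_succ_top (Nat.zero_le n), mul_add]
      calc ‖g (n + 1) - g 0‖ = ‖(g n - g 0) - (g n - g (n + 1))‖ := by congr 1; ring
        _ ≤ ‖g n - g 0‖ + ‖g n - g (n + 1)‖ := norm_sub_le _ _
        _ ≤ _ := add_le_add (ih (by omega)) h1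
  -- The double sum for `g 0 - g n` with `g 0` subtracted inside; the constant part reproduces the
  -- mean.
  have htel : ∀ n ≤ a, g 0 - g n - κ * (∑ c ∈ Finset.Ioc 0 n, X.res c * X.head c : ℝ) * g 0 =
      κ * ∑ c ∈ Finset.Ioc 0 n, X.res c • ∑ y ∈ Finset.range c, X.stat y • (g y - g 0) := by
    intro n hn
    induction n with
    | zero => simp
    | succ n ih =>
      have h1 := ih (by omega)
      have h2 := hstep n hn
      rw [Finset.sum_Ioc_succ_top (Nat.zero_le n), Finset.sum_Ioc_succ_top (Nat.zero_le n),
        mul_add, ← h1]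
      have h3 : ∑ y ∈ Finset.range (n + 1), X.stat y • (κ * g y) =
          κ * ∑ y ∈ Finset.range (n + 1), X.stat y • (g y - g 0) + κ * X.head (n + 1) * g 0 := by
        rw [head, Complex.ofReal_sum, Finset.mul_sum, Finset.mul_sum, Finset.sum_mul,
          ← Finset.sum_add_distrib]
        refine Finset.sum_congr rfl fun y _ => ?_
        simp only [Complex.real_smul]
        ring
      rw [h3] at h2
      simp only [Complex.real_smul] at h2 ⊢
      push_cast
      linear_combination h2
  have hfin := htel a le_rfl
  rw [hga, ← X.hitSum_last_eq 0 (Nat.zero_le a)] at hfin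
  rw [hfin, norm_mul, ← sq_abs θ, pow_two, mul_assoc]
  refine mul_le_mul hκn ?_ (norm_nonneg _) (abs_nonneg _)
  rw [← mul_assoc, mul_comm |θ|, mul_assoc, Finset.sum_mul]
  refine norm_sum_le_of_le _ fun c hc => ?_
  have hc := Finset.mem_Ioc.1 hc
  have hr := X.res_pos hc.1 hc.2
  rw [norm_smul, Real.norm_of_nonneg hr.le]
  refine mul_le_mul_of_nonneg_left ?_ hr.le
  have h1 : ‖∑ y ∈ Finset.range c, X.stat y • (g y - g 0)‖ ≤
      ∑ y ∈ Finset.range c, X.stat y * (|θ| * ∑ d ∈ Finset.Ioc 0 y, X.res d * X.head d) := by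
    refine norm_sum_le_of_le _ fun y hy => ?_
    have hy : y < c := Finset.mem_range.1 hy
    have hs := X.stat_pos (x := y) (by omega)
    rw [norm_smul, Real.norm_of_nonneg hs.le]
    exact mul_le_mul_of_nonneg_left (hdist y (by omega)) hs.le
  refine h1.trans ?_
  have h2 : ∑ y ∈ Finset.range c, X.stat y * (|θ| * ∑ d ∈ Finset.Ioc 0 y, X.res d * X.head d) =
      |θ| * ∑ y ∈ Finset.range c, X.stat y * ∑ d ∈ Finset.Ioc 0 y, X.res d * X.head d := by
    rw [Finset.mul_sum]
    exact Finset.sum_congr rfl fun y _ => by ring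
  rw [h2]
  refine mul_le_mul_of_nonneg_left ?_ (abs_nonneg _)
  have hpos : ∀ d, 1 ≤ d → d ≤ a → X.res d * X.head d ≤ X.res d := fun d hd1 hd => by
    have h3 := X.head_add_tail (x := d) (by omega)
    have h4 := X.tail_pos hd
    have h5 := X.res_pos hd1 hd
    nlinarith
  -- Bounding `head` by `1` and exchanging the sums turns the `π`-average of the resistance from `0`
  -- to `y` into `∑ res d * tail d`, the mean time from `a` to `0`.
  calc ∑ y ∈ Finset.range c, X.stat y * ∑ d ∈ Finset.Ioc 0 y, X.res d * X.head d
      ≤ ∑ y ∈ Finset.Icc 0 a, X.stat y * ∑ d ∈ Finset.Ioc 0 y, X.res d := by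
        refine (Finset.sum_le_sum fun y hy => ?_).trans
          (Finset.sum_le_sum_of_subset_of_nonneg (fun y hy => ?_) fun y hy _ => ?_)
        · have hy : y < c := Finset.mem_range.1 hy
          refine mul_le_mul_of_nonneg_left (Finset.sum_le_sum fun d hd => ?_)
            (X.stat_pos (by omega)).le
          have hd := Finset.mem_Ioc.1 hd
          exact hpos d hd.1 (by omega)
        · have hy : y < c := Finset.mem_range.1 hy
          exact Finset.mem_Icc.2 ⟨Nat.zero_le y, by omega⟩
        · have hy := Finset.mem_Icc.1 hy
          refine mul_nonneg (X.stat_pos hy.2).le (Finset.sum_nonneg fun d hd => ?_)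
          have hd := Finset.mem_Ioc.1 hd
          exact (X.res_pos hd.1 (by omega)).le
    _ = X.hitSum 0 a := by
        rw [hitSum_zero_eq]
        simp only [Finset.mul_sum, tail]
        rw [Finset.sum_comm' (t' := Finset.Ioc 0 a) (s' := fun d => Finset.Icc d a)]
        · exact Finset.sum_congr rfl fun d _ => Finset.sum_congr rfl fun y _ => mul_comm _ _
        · intro y d
          simp only [Finset.mem_Icc, Finset.mem_Ioc]
          omega

end BirthDeathChain

/-! ### The exponential limit and uniform integrability. -/

lemma charFun_expMeasure_one (s : ℝ) :
    charFun (expMeasure 1) s = 1 / (1 - s * Complex.I) := by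
  have hdens : ∀ x : ℝ, (gammaPDF 1 1 x).toReal • Complex.exp (s * x * Complex.I) =
      (Set.Ici (0 : ℝ)).indicator (fun x : ℝ => Complex.exp ((s * Complex.I - 1) * x)) x := by
    intro x
    change (exponentialPDF 1 x).toReal • _ = _
    by_cases hx : 0 ≤ x
    · rw [Set.indicator_of_mem (by simpa using hx), exponentialPDF_of_nonneg hx,
        ENNReal.toReal_ofReal (by positivity), Complex.real_smul]
      push_cast
      rw [one_mul, ← Complex.exp_add]
      congr 1
      ring
    · rw [Set.indicator_of_notMem (by simpa using hx), exponentialPDF_of_neg (not_le.1 hx)]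
      simp
  rw [charFun_apply_real, expMeasure, gammaMeasure,
    integral_withDensity_eq_integral_toReal_smul (f := gammaPDF 1 1)
      (measurable_gammaPDFReal 1 1).ennreal_ofReal
      (ae_of_all _ fun x => ENNReal.ofReal_lt_top)]
  simp only [hdens]
  rw [integral_indicator measurableSet_Ici, integral_Ici_eq_integral_Ioi,
    integral_exp_mul_complex_Ioi (by simp)]
  rw [Complex.ofReal_zero, mul_zero, Complex.exp_zero, neg_div, ← div_neg, neg_sub]

namespace BirthDeathChain

/-- The second moment of the time from `0` to `a` is at most twice the square of its mean. -/
lemma lintegral_hit_last_sq_le {a : ℕ} (X : BirthDeathChain a) :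
    ∫⁻ ω, hit {Fin.last a} ω ^ 2 ∂X.pathLaw 0 ≤
      2 * X.meanHit 0 {Fin.last a} ^ 2 := by
  refine (X.lintegral_hit_singleton_le (z := Fin.last a) (m := X.hitSum a 0)
    (fun y hy => X.hitSum_last_le hy) 0).2.trans (le_of_eq ?_)
  have h0 : 0 ≤ X.hitSum a 0 := X.hitSum_nonneg le_rfl (Nat.zero_le a)
  rw [meanHit_last, Fin.val_zero, Fin.val_last, ← ENNReal.ofReal_pow h0, mul_assoc,
    ENNReal.ofReal_mul zero_le_two, ENNReal.ofReal_ofNat, pow_two]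

lemma meanHit_last_pos {a : ℕ} (X : BirthDeathChain a) (ha : 1 ≤ a) :
    0 < X.meanHit 0 {Fin.last a} := by
  rw [meanHit_last, ENNReal.ofReal_pos]
  have : (1 : ℝ) ≤ a := by exact_mod_cast ha
  exact lt_of_lt_of_le (by linarith) X.le_hitSum_last

/-- No asymptotic hypothesis enters: the normalised times have second moment at most `2`, and `S ≤
S²/n` where `S > n`, so any `n` with `1/n < ε/2` serves as `K`. -/
lemma normalizedUnifIntegrable (X : ∀ a, BirthDeathChain a) :
    NormalizedUnifIntegrable (fun a => (X a).pathLaw 0) (fun a => hit {Fin.last a}) := by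
  intro ε hε
  obtain ⟨n, hn⟩ := ENNReal.exists_inv_nat_lt (ENNReal.div_pos hε.ne' ENNReal.ofNat_ne_top
    (b := 2)).ne'
  have hn0 : (n : ℝ≥0∞) ≠ 0 := by
    rintro h
    rw [h, ENNReal.inv_zero] at hn
    exact not_top_lt hn
  refine ⟨n, fun a ha => ?_⟩
  set M := ∫⁻ ω', hit {Fin.last a} ω' ∂(X a).pathLaw 0 with hM
  have hM0 : M ≠ 0 := ((X a).meanHit_last_pos ha).ne'
  have hMt : M ≠ ∞ := ((X a).meanHit_lt_top _ _).ne
  have hm := measurable_hit ({Fin.last a} : Set (Fin (a + 1)))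
  have h2 := (X a).lintegral_hit_last_sq_le
  rw [show (X a).meanHit 0 {Fin.last a} = M from rfl] at h2
  calc ∫⁻ ω in {ω | ((n : ℝ≥0) : ℝ≥0∞) < hit {Fin.last a} ω / M}, hit {Fin.last a} ω / M
        ∂(X a).pathLaw 0
      ≤ ∫⁻ ω in {ω | ((n : ℝ≥0) : ℝ≥0∞) < hit {Fin.last a} ω / M},
        hit {Fin.last a} ω ^ 2 * (M⁻¹ ^ 2 * (n : ℝ≥0∞)⁻¹) ∂(X a).pathLaw 0 := by
        refine setLIntegral_mono' (measurableSet_lt measurable_const (hm.div_const M))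
          fun ω hω => ?_
        have hω' : (n : ℝ≥0∞) ≤ hit {Fin.last a} ω / M := by
          have : ((n : ℝ≥0) : ℝ≥0∞) < hit {Fin.last a} ω / M := hω
          simpa using this.le
        calc hit {Fin.last a} ω / M
            = hit {Fin.last a} ω / M * (n * (n : ℝ≥0∞)⁻¹) := by
              rw [ENNReal.mul_inv_cancel hn0 (ENNReal.natCast_ne_top n), mul_one]
          _ ≤ hit {Fin.last a} ω / M * (hit {Fin.last a} ω / M * (n : ℝ≥0∞)⁻¹) := by gcongr
          _ = _ := by rw [div_eq_mul_inv]; ring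
    _ ≤ ∫⁻ ω, hit {Fin.last a} ω ^ 2 * (M⁻¹ ^ 2 * (n : ℝ≥0∞)⁻¹) ∂(X a).pathLaw 0 :=
        setLIntegral_le_lintegral _ _
    _ = (∫⁻ ω, hit {Fin.last a} ω ^ 2 ∂(X a).pathLaw 0) * (M⁻¹ ^ 2 * (n : ℝ≥0∞)⁻¹) :=
        lintegral_mul_const _ (hm.pow_const 2)
    _ ≤ 2 * M ^ 2 * (M⁻¹ ^ 2 * (n : ℝ≥0∞)⁻¹) := by gcongr
    _ = 2 * (n : ℝ≥0∞)⁻¹ * (M * M⁻¹) ^ 2 := by ring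
    _ = 2 * (n : ℝ≥0∞)⁻¹ := by rw [ENNReal.mul_inv_cancel hM0 hMt]; simp
    _ < ε := by
        rw [mul_comm]
        exact (ENNReal.lt_div_iff_mul_lt (Or.inl two_ne_zero)
          (Or.inl ENNReal.ofNat_ne_top)).1 hn

/-! ### Asymptotics: escape from `0` to `a`. -/

lemma tendsto_ratio_of_tendsto {B A : ℕ → ℝ} (hB : ∀ a, 1 ≤ a → 0 ≤ B a)
    (hA : ∀ a, 1 ≤ a → 0 < A a)
    (h : Tendsto (fun a => ENNReal.ofReal (B a) / ENNReal.ofReal (A a)) atTop (𝓝 0)) :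
    Tendsto (fun a => B a / A a) atTop (𝓝 0) := by
  have h1 := (ENNReal.tendsto_toReal ENNReal.zero_ne_top).comp h
  rw [ENNReal.toReal_zero] at h1
  refine h1.congr' ?_
  filter_upwards [eventually_ge_atTop 1] with a ha
  rw [Function.comp_apply, ENNReal.toReal_div, ENNReal.toReal_ofReal (hB a ha),
    ENNReal.toReal_ofReal (hA a ha).le]

/-- The consequences of the hypothesis for the sums of resistances. -/
lemma ratio_bounds {a : ℕ} (X : BirthDeathChain a) (ha : 1 ≤ a) {β : ℝ}
    (hβ : X.tail 1 * X.Q 1 / X.hitSum 0 a ≤ β) (hβ' : β ≤ 1 / 2) :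
    X.hitSum 0 a / X.hitSum a 0 ≤ 2 * β ∧
      (∑ c ∈ Finset.Ioc 0 a, X.res c) * X.hitSum 0 a / X.hitSum a 0 ^ 2 ≤ 4 * β := by
  set R := ∑ c ∈ Finset.Ioc 0 a, X.res c with hR
  have hA := X.hitSum_zero_pos ha
  have h1 := X.hitSum_zero_sq_le ha
  have h2 := X.sum_res_sub
  have hm : 0 < X.hitSum a 0 := by
    have : (1 : ℝ) ≤ a := by exact_mod_cast ha
    linarith [X.le_hitSum_last]
  rw [← hR] at h1 h2
  have hR0 : 0 < R := by linarith
  rw [div_le_iff₀ hA] at hβ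
  -- Cauchy–Schwarz gives `A² ≤ β A R`; divide by `A`.
  have h3 : X.hitSum 0 a ≤ β * R := by
    have : X.hitSum 0 a * X.hitSum 0 a ≤ X.hitSum 0 a * (β * R) := by
      calc X.hitSum 0 a * X.hitSum 0 a = X.hitSum 0 a ^ 2 := by ring
        _ ≤ (X.tail 1 * X.Q 1) * R := h1
        _ ≤ (β * X.hitSum 0 a) * R := by gcongr
        _ = _ := by ring
    exact le_of_mul_le_mul_left this hA
  -- Here `β ≤ 1/2` is used: `A ≤ R/2`, so `M = R - A ≥ R/2`.
  have h4 : R ≤ 2 * X.hitSum a 0 := by nlinarith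
  have hβ0 : 0 < β := by
    by_contra! h
    nlinarith
  have h5 : X.hitSum 0 a ≤ 2 * β * X.hitSum a 0 := by nlinarith
  refine ⟨(div_le_iff₀ hm).2 h5, (div_le_iff₀ (by positivity)).2 ?_⟩
  calc R * X.hitSum 0 a ≤ (2 * X.hitSum a 0) * (2 * β * X.hitSum a 0) := by gcongr
    _ = _ := by ring

section asymptotics

variable {X : ∀ a, BirthDeathChain a}

lemma tendsto_ratios
    (h : Tendsto (fun a => (X a).tail 1 * (X a).Q 1 / (X a).hitSum 0 a) atTop (𝓝 0)) :
    Tendsto (fun a => (X a).hitSum 0 a / (X a).hitSum a 0) atTop (𝓝 0) ∧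
    Tendsto (fun a => (∑ c ∈ Finset.Ioc 0 a, (X a).res c) * (X a).hitSum 0 a /
      (X a).hitSum a 0 ^ 2) atTop (𝓝 0) := by
  have hev : ∀ᶠ a in atTop, (X a).tail 1 * (X a).Q 1 / (X a).hitSum 0 a ≤ 1 / 2 :=
    h.eventually_le_const (by norm_num)
  have h0 : ∀ a, 0 ≤ (X a).hitSum 0 a := fun a => (X a).hitSum_nonneg (Nat.zero_le a) le_rfl
  have h0' : ∀ a, 0 ≤ (X a).hitSum a 0 := fun a => (X a).hitSum_nonneg le_rfl (Nat.zero_le a)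
  have hR : ∀ a, 0 ≤ ∑ c ∈ Finset.Ioc 0 a, (X a).res c := fun a =>
    Finset.sum_nonneg fun c hc => by
      have := Finset.mem_Ioc.1 hc
      exact ((X a).res_pos this.1 this.2).le
  constructor
  · refine tendsto_of_tendsto_of_tendsto_of_le_of_le' tendsto_const_nhds
      (by simpa using h.const_mul 2) (.of_forall fun a => div_nonneg (h0 a) (h0' a)) ?_
    filter_upwards [hev, eventually_ge_atTop 1] with a h1 h2
    exact ((X a).ratio_bounds h2 le_rfl h1).1
  · refine tendsto_of_tendsto_of_tendsto_of_le_of_le' tendsto_const_nhds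
      (by simpa using h.const_mul 4)
      (.of_forall fun a => div_nonneg (mul_nonneg (hR a) (h0 a)) (sq_nonneg _)) ?_
    filter_upwards [hev, eventually_ge_atTop 1] with a h1 h2
    exact ((X a).ratio_bounds h2 le_rfl h1).2

lemma tendsto_iSup_meanHit_div
    (h : Tendsto (fun a => (X a).hitSum 0 a / (X a).hitSum a 0) atTop (𝓝 0)) :
    Tendsto (fun a => (⨆ x, (X a).meanHit x {0}) / (X a).meanHit 0 {Fin.last a})
      atTop (𝓝 0) := by
  have h1 := ENNReal.tendsto_ofReal h
  rw [ENNReal.ofReal_zero] at h1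
  refine tendsto_of_tendsto_of_tendsto_of_le_of_le' tendsto_const_nhds h1
    (.of_forall fun a => zero_le) ?_
  filter_upwards [eventually_ge_atTop 1] with a ha
  have hm : 0 < (X a).hitSum a 0 := by
    have : (1 : ℝ) ≤ a := by exact_mod_cast ha
    linarith [(X a).le_hitSum_last]
  rw [ENNReal.ofReal_div_of_pos hm, meanHit_last, Fin.val_zero]
  gcongr
  refine iSup_le fun x => ((X a).meanHit_le x 0).trans (ENNReal.ofReal_le_ofReal ?_)
  exact (X a).hitSum_zero_le (by omega)

/-- The second-order Taylor bound for the exponential at `-is/m`, multiplied by `m`: it says that `κ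
m` is close to `is` when `θ = s/m`. -/
lemma norm_exp_sub_one_sub_le (s m : ℝ) (hm : 0 < m) (hs : |s| ≤ m) :
    ‖(1 - Complex.exp (-((s / m : ℝ) * Complex.I))) * m - s * Complex.I‖ ≤ s ^ 2 / m := by
  have h1 : ‖(-((s / m : ℝ) * Complex.I) : ℂ)‖ = |s| / m := by
    rw [norm_neg, norm_mul, Complex.norm_I, mul_one, Complex.norm_real, Real.norm_eq_abs, abs_div,
      abs_of_pos hm]
  have h2 := Complex.norm_exp_sub_one_sub_id_le (x := -((s / m : ℝ) * Complex.I))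
    (by rw [h1, div_le_one hm]; exact hs)
  have h3 : (1 - Complex.exp (-((s / m : ℝ) * Complex.I))) * m - s * Complex.I =
      -(m : ℂ) * (Complex.exp (-((s / m : ℝ) * Complex.I)) - 1 - -((s / m : ℝ) * Complex.I)) := by
    have : (m : ℂ) ≠ 0 := Complex.ofReal_ne_zero.2 hm.ne'
    push_cast
    field_simp
    ring
  rw [h3, norm_mul, norm_neg, Complex.norm_real, Real.norm_of_nonneg hm.le]
  calc _ ≤ m * (|s| / m) ^ 2 := by rw [h1] at h2; gcongr
    _ = s ^ 2 / m := by rw [div_pow, sq_abs]; field_simp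

lemma tendsto_hitChar
    (h : Tendsto (fun a => (∑ c ∈ Finset.Ioc 0 a, (X a).res c) * (X a).hitSum 0 a /
      (X a).hitSum a 0 ^ 2) atTop (𝓝 0)) (s : ℝ) :
    Tendsto (fun a => (X a).hitChar (Fin.last a) 0 (s / (X a).hitSum a 0)) atTop
      (𝓝 (1 / (1 - s * Complex.I))) := by
  have hminf : Tendsto (fun a => (X a).hitSum a 0) atTop atTop :=
    tendsto_atTop_mono (fun a => (X a).le_hitSum_last) tendsto_natCast_atTop_atTop
  have hlim : Tendsto (fun a => s ^ 2 / (X a).hitSum a 0 + s ^ 2 *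
      ((∑ c ∈ Finset.Ioc 0 a, (X a).res c) * (X a).hitSum 0 a /
      (X a).hitSum a 0 ^ 2)) atTop (𝓝 0) := by
    simpa using (hminf.const_div_atTop (s ^ 2)).add (h.const_mul (s ^ 2))
  have hden : 1 ≤ ‖(1 - s * Complex.I : ℂ)‖ := by
    have := Complex.abs_re_le_norm (1 - s * Complex.I)
    simpa using this
  have hden0 : (1 - s * Complex.I : ℂ) ≠ 0 := norm_pos_iff.1 (by linarith)
  rw [tendsto_iff_norm_sub_tendsto_zero]
  refine tendsto_of_tendsto_of_tendsto_of_le_of_le' tendsto_const_nhds hlim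
    (.of_forall fun a => norm_nonneg _) ?_
  filter_upwards [hminf.eventually_ge_atTop |s|, hminf.eventually_gt_atTop 0] with a hs hm
  set m := (X a).hitSum a 0
  set φ := (X a).hitChar (Fin.last a) 0 (s / m)
  have h1 := (X a).norm_hitChar_last_sub_le (s / m)
  have h2 := norm_exp_sub_one_sub_le s m hm hs
  have h3 : ‖φ‖ ≤ 1 := (X a).norm_hitChar_le _ _ _
  -- Multiplying by `1 - is`, whose modulus is at least `1`, avoids dividing by `1 - κ m`. The error
  -- then splits into the Taylor error and the error of the geometric comparison.
  have h4 : ‖(φ - 1 / (1 - s * Complex.I)) * (1 - s * Complex.I)‖ ≤ s ^ 2 / m + s ^ 2 *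
      ((∑ c ∈ Finset.Ioc 0 a, (X a).res c) * (X a).hitSum 0 a / m ^ 2) := by
    have : (φ - 1 / (1 - s * Complex.I)) * (1 - s * Complex.I) =
        ((1 - Complex.exp (-((s / m : ℝ) * Complex.I))) * m - s * Complex.I) * φ +
        (φ - 1 - (1 - Complex.exp (-((s / m : ℝ) * Complex.I))) * m * φ) := by
      rw [sub_mul, one_div_mul_cancel hden0]
      ring
    rw [this]
    refine (norm_add_le _ _).trans (add_le_add ?_ (h1.trans (le_of_eq ?_)))
    · rw [norm_mul]
      exact (mul_le_of_le_one_right (norm_nonneg _) h3).trans h2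
    · rw [div_pow]; ring
  rw [norm_mul] at h4
  exact (le_mul_of_one_le_right (norm_nonneg _) hden).trans h4

lemma exhibitsEscape
    (h : Tendsto (fun a => (∑ c ∈ Finset.Ioc 0 a, (X a).res c) * (X a).hitSum 0 a /
      (X a).hitSum a 0 ^ 2) atTop (𝓝 0)) :
    ExhibitsEscape (fun a => (X a).pathLaw 0) (fun a => hit {Fin.last a}) := by
  have hmeas : ∀ a, Measurable
      (normalized (fun a => (X a).pathLaw 0) (fun a => hit {Fin.last a}) a) := fun a =>
    ((measurable_hit _).div_const _).ennreal_toReal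
  refine ⟨fun a => (hmeas a).aemeasurable, aemeasurable_id, ?_⟩
  refine ProbabilityMeasure.tendsto_iff_tendsto_charFun.2 fun s => ?_
  change Tendsto (fun a => charFun (((X a).pathLaw 0).map _) s) atTop
    (𝓝 (charFun ((expMeasure 1).map id) s))
  rw [Measure.map_id, charFun_expMeasure_one]
  refine (tendsto_hitChar h s).congr fun a => ?_
  rw [charFun_apply_real, integral_map (hmeas a).aemeasurable (by fun_prop), hitChar]
  refine integral_congr_ae (ae_of_all _ fun ω => ?_)
  have h0 : 0 ≤ (X a).hitSum a 0 := (X a).hitSum_nonneg le_rfl (Nat.zero_le a)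
  have h1 : ∫⁻ ω', hit {Fin.last a} ω' ∂(X a).pathLaw 0 = ENNReal.ofReal ((X a).hitSum a 0) :=
    (X a).meanHit_last 0
  simp only [normalized, h1, ENNReal.toReal_div, ENNReal.toReal_ofReal h0]
  congr 2
  push_cast
  ring

end asymptotics

end BirthDeathChain

/-! ### Variance and cut-off for the time from `a` to `0`. -/

namespace BirthDeathChain

/-- The variance of `T / E[T]` for the time `T` from `a` to `0`, and the mean of `T / E[T]`. -/
lemma evariance_normalized_hit_zero_le (X : ∀ a, BirthDeathChain a) {a : ℕ} (ha : 1 ≤ a) :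
    evariance (normalized (fun a => (X a).pathLaw (Fin.last a)) (fun _ => hit {0}) a)
        ((X a).pathLaw (Fin.last a)) ≤
      ENNReal.ofReal (2 * ((X a).supQ / (X a).hitSum 0 a)) ∧
    ∫ ω, normalized (fun a => (X a).pathLaw (Fin.last a)) (fun _ => hit {0}) a ω
      ∂(X a).pathLaw (Fin.last a) = 1 := by
  set A := (X a).hitSum 0 a with hA
  have hA0 : 0 < A := (X a).hitSum_zero_pos ha
  have hQ : 0 ≤ (X a).supQ := ((X a).Q_nonneg le_rfl ha).trans ((X a).Q_le_supQ le_rfl ha)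
  have hmean : ∫⁻ ω, hit {0} ω ∂(X a).pathLaw (Fin.last a) = ENNReal.ofReal A :=
    (X a).meanHit_zero (Fin.last a)
  have hm := measurable_hit ({0} : Set (Fin (a + 1)))
  have hnorm : normalized (fun a => (X a).pathLaw (Fin.last a)) (fun _ => hit {0}) a =
      fun ω => (hit {0} ω / ENNReal.ofReal A).toReal := by
    funext ω
    rw [normalized, hmean]
  have hA1 : ENNReal.ofReal A ≠ 0 := (ENNReal.ofReal_pos.2 hA0).ne'
  have hint : ∫ ω, (hit {0} ω / ENNReal.ofReal A).toReal ∂(X a).pathLaw (Fin.last a) = 1 := by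
    rw [integral_toReal (hm.div_const _).aemeasurable]
    · simp only [div_eq_mul_inv]
      rw [lintegral_mul_const _ hm, hmean, ENNReal.mul_inv_cancel hA1 ENNReal.ofReal_ne_top,
        ENNReal.toReal_one]
    · filter_upwards [(X a).ae_hit_lt_top (Fin.last a) 0] with ω hω
      exact ENNReal.div_lt_top hω.ne hA1
  rw [hnorm]
  refine ⟨?_, hint⟩
  -- The normalised mean is `1`, so the variance is the second moment minus `1`; the truncated
  -- subtraction is moved to the other side.
  rw [evariance_def' (hm.div_const _).ennreal_toReal.aestronglyMeasurable, hint,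
    tsub_le_iff_right, one_pow, ← ENNReal.ofReal_add (by positivity) zero_le_one]
  calc ∫⁻ ω, ‖(hit {0} ω / ENNReal.ofReal A).toReal‖ₑ ^ 2 ∂(X a).pathLaw (Fin.last a)
      ≤ ∫⁻ ω, hit {0} ω ^ 2 * (ENNReal.ofReal A)⁻¹ ^ 2 ∂(X a).pathLaw (Fin.last a) := by
        refine lintegral_mono fun ω => ?_
        dsimp only
        rw [← mul_pow, ← div_eq_mul_inv, Real.enorm_of_nonneg ENNReal.toReal_nonneg]
        gcongr
        exact ENNReal.ofReal_toReal_le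
    _ = (∫⁻ ω, hit {0} ω ^ 2 ∂(X a).pathLaw (Fin.last a)) * (ENNReal.ofReal A)⁻¹ ^ 2 :=
        lintegral_mul_const _ (hm.pow_const 2)
    _ ≤ ENNReal.ofReal (A ^ 2 + 2 * (X a).supQ * A) * (ENNReal.ofReal A)⁻¹ ^ 2 := by
        gcongr
        exact (X a).lintegral_hit_zero_sq_le
    _ = ENNReal.ofReal (2 * ((X a).supQ / A) + 1) := by
        rw [← ENNReal.ofReal_inv_of_pos hA0, ← ENNReal.ofReal_pow (by positivity),
          ← ENNReal.ofReal_mul (by positivity)]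
        congr 1
        field_simp
        ring

variable {X : ∀ a, BirthDeathChain a}

lemma tendsto_evariance
    (h : Tendsto (fun a => (X a).supQ / (X a).hitSum 0 a) atTop (𝓝 0)) :
    Tendsto (fun a => evariance
      (normalized (fun a => (X a).pathLaw (Fin.last a)) (fun _ => hit {0}) a)
        ((X a).pathLaw (Fin.last a))) atTop (𝓝 0) := by
  have h1 := ENNReal.tendsto_ofReal (h.const_mul 2)
  rw [mul_zero, ENNReal.ofReal_zero] at h1
  refine tendsto_of_tendsto_of_tendsto_of_le_of_le' tendsto_const_nhds h1
    (.of_forall fun a => zero_le) ?_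
  filter_upwards [eventually_ge_atTop 1] with a ha
  exact (evariance_normalized_hit_zero_le X ha).1

/-- Chebyshev's inequality around the mean `1`. -/
lemma exhibitsCutoff
    (h : Tendsto (fun a => evariance
      (normalized (fun a => (X a).pathLaw (Fin.last a)) (fun _ => hit {0}) a)
        ((X a).pathLaw (Fin.last a))) atTop (𝓝 0)) :
    ExhibitsCutoff (fun a => (X a).pathLaw (Fin.last a)) (fun _ => hit {0}) := by
  intro ε hε
  have hε' : ε.toNNReal ≠ 0 := (Real.toNNReal_pos.2 hε).ne'
  have h1 := ENNReal.Tendsto.div_const (b := ((ε.toNNReal : ℝ≥0∞)) ^ 2) h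
    (Or.inr (by simpa using hε))
  rw [ENNReal.zero_div] at h1
  refine tendsto_of_tendsto_of_tendsto_of_le_of_le' tendsto_const_nhds h1
    (.of_forall fun a => zero_le) ?_
  filter_upwards [eventually_ge_atTop 1] with a ha
  have hmeas : Measurable
      (normalized (fun a => (X a).pathLaw (Fin.last a)) (fun _ => hit {0}) a) :=
    ((measurable_hit _).div_const _).ennreal_toReal
  have h2 := meas_ge_le_evariance_div_sq (μ := (X a).pathLaw (Fin.last a))
    hmeas.aestronglyMeasurable hε'
  rw [(evariance_normalized_hit_zero_le X ha).2, Real.coe_toNNReal _ hε.le] at h2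
  refine (measure_mono fun ω hω => ?_).trans h2
  exact le_of_lt (show ε < _ from hω)

end BirthDeathChain

theorem mainTheorem4 (X : ∀ a : ℕ, BirthDeathChain a) :
    -- all mean hitting times are finite
    (∀ (a : ℕ) (x y : Fin (a + 1)), (X a).meanHit x {y} < ∞) ∧
    -- (i)
    (Tendsto (fun a => ENNReal.ofReal ((X a).tail 1 * (X a).Q 1) / (X a).meanHit (Fin.last a) {0})
        atTop (𝓝 0) →
      MuchShorter X (fun a => {Fin.last a}) (fun _ => 0) ∧
      ExhibitsEscape (fun a => (X a).pathLaw 0) (fun a => BirthDeathChain.hit {Fin.last a})) ∧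
    -- (ii)
    (Tendsto (fun a => ENNReal.ofReal (X a).supQ / (X a).meanHit (Fin.last a) {0})
        atTop (𝓝 0) →
      Tendsto (fun a => evariance
          (normalized (fun a => (X a).pathLaw (Fin.last a)) (fun a => BirthDeathChain.hit {0}) a)
          ((X a).pathLaw (Fin.last a))) atTop (𝓝 0) ∧
      ExhibitsCutoff (fun a => (X a).pathLaw (Fin.last a)) (fun a => BirthDeathChain.hit {0})) := by
  have hA : ∀ a, 1 ≤ a → 0 < (X a).hitSum 0 a := fun a ha => (X a).hitSum_zero_pos ha
  refine ⟨fun a x y => (X a).meanHit_lt_top x y, fun h => ?_, fun h => ?_⟩ <;>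
    simp only [BirthDeathChain.meanHit_zero, Fin.val_last] at h
  · have h1 := BirthDeathChain.tendsto_ratios (BirthDeathChain.tendsto_ratio_of_tendsto
      (fun a ha => mul_nonneg ((X a).tail_pos ha).le ((X a).Q_nonneg le_rfl ha)) hA h)
    exact ⟨⟨BirthDeathChain.tendsto_iSup_meanHit_div h1.1,
      BirthDeathChain.normalizedUnifIntegrable X⟩, BirthDeathChain.exhibitsEscape h1.2⟩
  · have h1 := BirthDeathChain.tendsto_evariance (BirthDeathChain.tendsto_ratio_of_tendsto
      (fun a ha => ((X a).Q_nonneg le_rfl ha).trans ((X a).Q_le_supQ le_rfl ha)) hA h)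
    exact ⟨h1, BirthDeathChain.exhibitsCutoff h1⟩
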